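/- Let $g\ge 0$, let $H_{\mathbb Z}=\mathbb Z^{2g}$ with the symplectic form $Q$ of matrix $\begin{pmatrix}0&I\\-I&0\end{pmatrix}$, and let $(h'^{p,-p-1})_{p\in\mathbb Z}$ be nonnegative integers, almost all zero, with $h'^{-p-1,p}=h'^{p,-p-1}$ and $\sum_{p\ge 0}h'^{p,-p-1}=g$. Let $D'$ be the period domain of all Hodge structures of weight $-1$ on $H$ with these Hodge numbers that are polarized by $Q$ (with $F^p\perp_Q F^{-p}$, and $i^{p-q}Q(v,\bar v)>0$ for $0\ne v\in H^{p,q}$, $q=-p-1$), topologized as a subspace of a flag manifold. Let $\mathscr H'$ be the Siegel space of degree $g$, i.e. the period domain with Hodge numbers $h^{0,-1}=h^{-1,0}=g$, and let $p'^{\mathrm{ev}}:D'\to\mathscr H'$ be the even map, which sends $F$ to the Hodge structure with $\tilde F^{-1}=H_{\mathbb C}$, $\tilde F^0=\bigoplus_{p\ \mathrm{even}}H^{p,-p-1}$, $\tilde F^1=0$. It is equivariant for $Sp(g,\mathbb R)$, the group of automorphisms of $(H_{\mathbb R},Q)$. Let $\Gamma'\subset Sp(g,\mathbb R)$ be an arithmetic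 subgroup (i.e. commensurable with $Sp(g,\mathbb Z)$) which is neat (i.e. for every $\gamma\in\Gamma'$ the subgroup of $\mathbb C^\times$ generated by the eigenvalues of $\gamma$ is torsion-free). Then: 1. The map $p'^{\mathrm{ev}}:\Gamma'\backslash D'\to\Gamma'\backslash\mathscr H'$ induced by the even map is a fiber bundle (locally trivial, for the quotient topologies) with fiber $C'=U(g)/\prod_{p\ge 0}U(h'^{p,-p-1})$, where the product is embedded as block-diagonal unitary matrices. 2. $C'$ is a compact manifold: it is compact, Hausdorff and locally Euclidean of dimension $g^2-\sum_{p\ge0}(h'^{p,-p-1})^2$. 3. $\Gamma'\cap K=\{1\}$ for every maximal compact subgroup $K$ of $Sp(g,\mathbb R)$. -/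

import Mathlib

open scoped Matrix
open Module

noncomputable section

namespace WeightNegOne

/-- The complexification `H_ℂ` of the standard lattice of rank `2g`. -/
abbrev HC (g : ℕ) : Type := EuclideanSpace ℂ (Fin g ⊕ Fin g)

/-- The symplectic form with matrix `(0 I; -I 0)`, extended `ℂ`-bilinearly. -/
def Q (g : ℕ) : HC g →ₗ[ℂ] HC g →ₗ[ℂ] ℂ :=
  LinearMap.mk₂ ℂ
    (fun v w => WithLp.ofLp v ⬝ᵥ ((Matrix.fromBlocks 0 1 (-1) 0 :
      Matrix (Fin g ⊕ Fin g) (Fin g ⊕ Fin g) ℂ) *ᵥ WithLp.ofLp w))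
    (fun _ _ _ => by simp [add_dotProduct])
    (fun _ _ _ => by simp)
    (fun _ _ _ => by simp [Matrix.mulVec_add, dotProduct_add])
    (fun _ _ _ => by simp [Matrix.mulVec_smul])

/-- Complex conjugation on `H_ℂ` with respect to `H_ℝ`. -/
def conj (g : ℕ) : HC g →ₛₗ[starRingEnd ℂ] HC g where
  toFun v := WithLp.toLp 2 (fun i => starRingEnd ℂ (v i))
  map_add' _ _ := by ext; simp
  map_smul' _ _ := by ext; simp

@[simp] lemma conj_apply {g : ℕ} (v : HC g) (i : Fin g ⊕ Fin g) :
    conj g v i = starRingEnd ℂ (v i) := rfl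

@[simp] lemma conj_conj {g : ℕ} (v : HC g) : conj g (conj g v) = v := by ext; simp

/-- The complex conjugate of a subspace of `H_ℂ`. -/
def conjSub {g : ℕ} (V : Submodule ℂ (HC g)) : Submodule ℂ (HC g) := V.comap (conj g)

@[simp] lemma mem_conjSub {g : ℕ} {V : Submodule ℂ (HC g)} {v : HC g} :
    v ∈ conjSub V ↔ conj g v ∈ V := Iff.rfl

/-- The Hodge component `H^{p,-p-1} = F^p ∩ conj F^{-p-1}`. -/
def hodgePiece {g : ℕ} (F : ℤ → Submodule ℂ (HC g)) (p : ℤ) : Submodule ℂ (HC g) :=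
  F p ⊓ conjSub (F (-p - 1))

/-- `F` is the Hodge filtration of a Hodge structure of weight `-1` on `H` with Hodge numbers
`h^{p,-p-1} = h p`, polarized by `Q`. -/
structure IsPolarizedHodge (g : ℕ) (h : ℤ → ℕ) (F : ℤ → Submodule ℂ (HC g)) : Prop where
  antitone : Antitone F
  exhaustive : ∃ p, F p = ⊤
  separated : ∃ p, F p = ⊥
  isCompl : ∀ p, IsCompl (F p) (conjSub (F (-p)))
  finrank_piece : ∀ p, finrank ℂ (hodgePiece F p) = h p
  isotropic : ∀ p, ∀ v ∈ F p, ∀ w ∈ F (-p), Q g v w = 0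
  pos : ∀ p, ∀ v ∈ hodgePiece F p, v ≠ 0 →
    0 < (Complex.I ^ (p - (-p - 1)) * Q g v (conj g v)).re

/-- The period domain of polarized Hodge structures of weight `-1` with Hodge numbers
`h^{p,-p-1} = h p`. -/
def Domain (g : ℕ) (h : ℤ → ℕ) : Type :=
  {F : ℤ → Submodule ℂ (HC g) // IsPolarizedHodge g h F}

/-- The topology as a subspace of a flag manifold: a subspace of `H_ℂ` is identified with the
orthogonal projection onto it. -/
instance (g : ℕ) (h : ℤ → ℕ) : TopologicalSpace (Domain g h) :=
  TopologicalSpace.induced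
    (fun F => fun p : ℤ => ((F.1 p).starProjection : HC g →L[ℂ] HC g)) inferInstance

/-- The Hodge numbers `h^{0,-1} = h^{-1,0} = g`. -/
def siegelNumbers (g : ℕ) (p : ℤ) : ℕ := if p = 0 ∨ p = -1 then g else 0

/-- The Siegel space of degree `g`, as a period domain. -/
abbrev Siegel (g : ℕ) : Type := Domain g (siegelNumbers g)

/-- The direct sum of the `H^{p,-p-1}` with `p` even. -/
def evenPart {g : ℕ} (F : ℤ → Submodule ℂ (HC g)) : Submodule ℂ (HC g) :=
  ⨆ k : ℤ, hodgePiece F (2 * k)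

/-- The filtration `⊤ ⊇ ⨁_{p even} H^{p,-p-1} ⊇ 0`, in degrees `-1`, `0`, `1`. -/
def evenFiltration {g : ℕ} (F : ℤ → Submodule ℂ (HC g)) (p : ℤ) : Submodule ℂ (HC g) :=
  if p < 0 then ⊤ else if p = 0 then evenPart F else ⊥

section basics

variable {g : ℕ}

lemma Q_apply (v w : HC g) :
    Q g v w = WithLp.ofLp v ⬝ᵥ ((Matrix.fromBlocks 0 1 (-1) 0 :
      Matrix (Fin g ⊕ Fin g) (Fin g ⊕ Fin g) ℂ) *ᵥ WithLp.ofLp w) := rfl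

lemma Q_sum (v w : HC g) :
    Q g v w = ∑ i, (v (.inl i) * w (.inr i) - v (.inr i) * w (.inl i)) := by
  simp [Q_apply, dotProduct, Matrix.mulVec, Fintype.sum_sum_type, Matrix.one_apply,
    Matrix.neg_apply, sub_eq_add_neg, Finset.sum_add_distrib]

lemma Q_swap (v w : HC g) : Q g w v = -Q g v w := by
  simp only [Q_sum, ← Finset.sum_neg_distrib]
  exact Finset.sum_congr rfl fun _ _ => by ring

lemma Q_conj (v w : HC g) : Q g (conj g v) (conj g w) = starRingEnd ℂ (Q g v w) := by
  simp [Q_sum, map_sum]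

lemma conjSub_conjSub (V : Submodule ℂ (HC g)) : conjSub (conjSub V) = V := by
  ext; simp

@[simp] lemma conjSub_top : conjSub (⊤ : Submodule ℂ (HC g)) = ⊤ := by ext; simp

@[simp] lemma conjSub_bot : conjSub (⊥ : Submodule ℂ (HC g)) = ⊥ := by
  ext v
  simp only [mem_conjSub, Submodule.mem_bot]
  refine ⟨fun hv => ?_, fun hv => by simp [hv]⟩
  rw [← conj_conj v, hv, map_zero]

lemma conjSub_mono {V W : Submodule ℂ (HC g)} (hVW : V ≤ W) : conjSub V ≤ conjSub W :=
  fun _ hv => hVW hv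

lemma finrank_conjSub (V : Submodule ℂ (HC g)) : finrank ℂ (conjSub V) = finrank ℂ V := by
  unfold finrank
  congr 1
  refine rank_eq_of_equiv_equiv (starRingEnd ℂ)
    (⟨⟨fun v => ⟨conj g v.1, v.2⟩, fun v => ⟨conj g v.1, by simp⟩,
      fun v => by simp, fun v => by simp⟩, fun _ _ => by ext; simp⟩ : conjSub V ≃+ V)
    (RingHomClass.toRingHom (starRingEnd ℂ) |> fun _ => Complex.conjAe.bijective) ?_
  intro r m
  ext i
  simp

lemma mem_hodgePiece_conj {F : ℤ → Submodule ℂ (HC g)} {p q : ℤ} (hpq : q = -p - 1) {v : HC g}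
    (hv : v ∈ hodgePiece F p) : conj g v ∈ hodgePiece F q := by
  subst hpq
  refine ⟨hv.2, ?_⟩
  have : -(-p - 1) - 1 = p := by ring
  simpa [this] using hv.1

lemma conj_mem_hodgePiece_iff {F : ℤ → Submodule ℂ (HC g)} {p q : ℤ} (hpq : q = -p - 1)
    {v : HC g} : conj g v ∈ hodgePiece F q ↔ v ∈ hodgePiece F p :=
  ⟨fun hv => by simpa using mem_hodgePiece_conj (p := q) (q := p) (by omega) hv,
    mem_hodgePiece_conj hpq⟩

lemma evenFiltration_neg (F : ℤ → Submodule ℂ (HC g)) {p : ℤ} (hp : p < 0) :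
    evenFiltration F p = ⊤ := if_pos hp

lemma evenFiltration_zero (F : ℤ → Submodule ℂ (HC g)) : evenFiltration F 0 = evenPart F := by
  simp [evenFiltration]

lemma evenFiltration_pos (F : ℤ → Submodule ℂ (HC g)) {p : ℤ} (hp : 0 < p) :
    evenFiltration F p = ⊥ := by
  rw [evenFiltration, if_neg (by omega), if_neg (by omega)]

lemma hodgePiece_evenFiltration (F : ℤ → Submodule ℂ (HC g)) (p : ℤ) :
    (p = 0 ∧ hodgePiece (evenFiltration F) p = evenPart F) ∨
    (p = -1 ∧ hodgePiece (evenFiltration F) p = conjSub (evenPart F)) ∨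
    (p ≠ 0 ∧ p ≠ -1 ∧ hodgePiece (evenFiltration F) p = ⊥) := by
  rcases lt_trichotomy p (-1) with hp | hp | hp
  · refine Or.inr (Or.inr ⟨by omega, by omega, ?_⟩)
    rw [hodgePiece, evenFiltration_pos F (p := -p - 1) (by omega), conjSub_bot, inf_bot_eq]
  · subst hp
    refine Or.inr (Or.inl ⟨rfl, ?_⟩)
    rw [hodgePiece, evenFiltration_neg F (p := -1) (by omega), top_inf_eq, neg_neg, sub_self,
      evenFiltration_zero]
  · rcases (show p = 0 ∨ 0 < p by omega) with hp | hp
    · subst hp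
      refine Or.inl ⟨rfl, ?_⟩
      rw [hodgePiece, evenFiltration_zero, evenFiltration_neg F (by omega), conjSub_top,
        inf_top_eq]
    · refine Or.inr (Or.inr ⟨by omega, by omega, ?_⟩)
      rw [hodgePiece, evenFiltration_pos F hp, bot_inf_eq]

end basics

namespace IsPolarizedHodge

variable {g : ℕ} {h : ℤ → ℕ} {F : ℤ → Submodule ℂ (HC g)}

lemma Q_eq_zero (hF : IsPolarizedHodge g h F) {p q : ℤ} (hpq : q ≠ -p - 1) {v w : HC g}
    (hv : v ∈ hodgePiece F p) (hw : w ∈ hodgePiece F q) : Q g v w = 0 := by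
  rcases lt_or_gt_of_ne hpq with hlt | hgt
  · have h1 : conj g w ∈ F (-(-p - 1)) := hF.antitone (by omega) hw.2
    have := hF.isotropic _ _ hv.2 _ h1
    rw [Q_conj] at this
    simpa using this
  · exact hF.isotropic p v hv.1 w (hF.antitone (by omega) hw.1)

lemma le_sup_even (hF : IsPolarizedHodge g h F) (p : ℤ) :
    F p ≤ evenPart F ⊔ conjSub (evenPart F) := by
  have hpiece : ∀ q, hodgePiece F q ≤ evenPart F ⊔ conjSub (evenPart F) := by
    intro q
    obtain ⟨k, rfl | rfl⟩ := Int.even_or_odd' q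
    · exact le_sup_of_le_left (le_iSup (fun k : ℤ => hodgePiece F (2 * k)) k)
    · refine le_sup_of_le_right fun v hv => ?_
      exact le_iSup (fun k : ℤ => hodgePiece F (2 * k)) (-k - 1)
        (mem_hodgePiece_conj (by ring) hv)
  have hstep : ∀ q, F q ≤ hodgePiece F q ⊔ F (q + 1) := by
    intro q v hv
    obtain ⟨a, ha, b, hb, hab⟩ := Submodule.mem_sup.1
      ((hF.isCompl (q + 1)).sup_eq_top ▸ Submodule.mem_top (x := v))
    have hbF : b ∈ F q := by
      have : b = v - a := by rw [← hab]; abel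
      rw [this]
      exact sub_mem hv (hF.antitone (by omega) ha)
    refine Submodule.mem_sup.2 ⟨b, ⟨hbF, ?_⟩, a, ha, by rw [← hab]; abel⟩
    have : -q - 1 = -(q + 1) := by ring
    rw [this]
    exact hb
  obtain ⟨m, hm⟩ := hF.separated
  rcases le_total p m with hp | hp
  · induction p, hp using Int.leInductionDown with
    | base => simp [hm]
    | pred n hn ih =>
      refine (hstep _).trans (sup_le (hpiece _) ?_)
      simpa using ih
  · exact (hF.antitone hp).trans (by simp [hm])

lemma Q_even (hF : IsPolarizedHodge g h F) {v w : HC g} (hv : v ∈ evenPart F)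
    (hw : w ∈ evenPart F) : Q g v w = 0 := by
  refine Submodule.iSup_induction _ (motive := fun v => Q g v w = 0) hv ?_ (by simp) ?_
  · intro k v hv
    refine Submodule.iSup_induction _ (motive := fun w => Q g v w = 0) hw ?_ (by simp) ?_
    · intro l w hw
      exact hF.Q_eq_zero (by omega) hv hw
    · intro x y hx hy
      simp [hx, hy]
  · intro x y hx hy
    simp [hx, hy]

lemma pos_even (hF : IsPolarizedHodge g h F) {v : HC g} (hv : v ∈ evenPart F) (hv0 : v ≠ 0) :
    0 < (Complex.I * Q g v (conj g v)).re := by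
  classical
  obtain ⟨f, hf⟩ := (Submodule.mem_iSup_iff_exists_dfinsupp' _ v).1 hv
  have hpos : ∀ k : ℤ, ∀ u ∈ hodgePiece F (2 * k), u ≠ 0 →
      0 < (Complex.I * Q g u (conj g u)).re := by
    intro k u hu hu0
    have := hF.pos _ u hu hu0
    have hI : Complex.I ^ (2 * k - (-(2 * k) - 1)) = Complex.I := by
      have : 2 * k - (-(2 * k) - 1) = 4 * k + 1 := by ring
      rw [this, zpow_add₀ Complex.I_ne_zero, zpow_mul]
      have : Complex.I ^ (4 : ℤ) = 1 := by exact_mod_cast Complex.I_pow_four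
      simp [this]
    rwa [hI] at this
  have hsum : Q g v (conj g v) =
      ∑ k ∈ f.support, Q g (f k : HC g) (conj g (f k : HC g)) := by
    rw [← hf, DFinsupp.sum, map_sum, LinearMap.sum_apply]
    refine Finset.sum_congr rfl fun k _ => ?_
    rw [map_sum, map_sum]
    refine Finset.sum_eq_single_of_mem k ‹_› fun l _ hl => ?_
    exact hF.Q_eq_zero (q := -(2 * l) - 1) (by omega) (f k).2
      (mem_hodgePiece_conj rfl (f l).2)
  rw [hsum, Finset.mul_sum, Complex.re_sum]
  refine Finset.sum_pos (fun k hk => hpos k _ (f k).2 ?_) ?_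
  · simpa using hk
  · rw [Finset.nonempty_iff_ne_empty]
    intro hs
    apply hv0
    rw [← hf, DFinsupp.sum, hs, Finset.sum_empty]

lemma isCompl_even (hF : IsPolarizedHodge g h F) :
    IsCompl (evenPart F) (conjSub (evenPart F)) := by
  constructor
  · rw [Submodule.disjoint_def]
    intro v hv hv'
    by_contra hv0
    have h1 := hF.pos_even hv hv0
    have h2 := hF.pos_even hv' (fun hc => hv0 (by rw [← conj_conj v, hc, map_zero]))
    rw [conj_conj, Q_swap, mul_neg, Complex.neg_re] at h2
    linarith
  · rw [codisjoint_iff, eq_top_iff]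
    obtain ⟨m, hm⟩ := hF.exhaustive
    exact hm ▸ hF.le_sup_even m

lemma finrank_even (hF : IsPolarizedHodge g h F) : finrank ℂ (evenPart F) = g := by
  have := Submodule.finrank_add_eq_of_isCompl hF.isCompl_even
  rw [finrank_conjSub] at this
  simp at this
  omega

/-- The even filtration is a point of the Siegel space. -/
lemma even (hF : IsPolarizedHodge g h F) :
    IsPolarizedHodge g (siegelNumbers g) (evenFiltration F) where
  antitone := by
    intro p q hpq
    unfold evenFiltration
    split_ifs <;> first | omega | simp
  exhaustive := ⟨-1, evenFiltration_neg F (by omega)⟩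
  separated := ⟨1, evenFiltration_pos F (by omega)⟩
  isCompl := by
    intro p
    rcases lt_trichotomy p 0 with hp | rfl | hp
    · rw [evenFiltration_neg F hp, evenFiltration_pos F (by omega), conjSub_bot]
      exact isCompl_top_bot
    · rw [neg_zero, evenFiltration_zero]
      exact hF.isCompl_even
    · rw [evenFiltration_pos F hp, evenFiltration_neg F (by omega), conjSub_top]
      exact isCompl_bot_top
  finrank_piece := by
    intro p
    rcases hodgePiece_evenFiltration F p with ⟨rfl, h1⟩ | ⟨rfl, h1⟩ | ⟨h0, h0', h1⟩
    · rw [h1, hF.finrank_even]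
      simp [siegelNumbers]
    · rw [h1, finrank_conjSub, hF.finrank_even]
      simp [siegelNumbers]
    · rw [h1, finrank_bot]
      simp [siegelNumbers, h0, h0']
  isotropic := by
    intro p v hv w hw
    rcases lt_trichotomy p 0 with hp | rfl | hp
    · rw [evenFiltration_pos F (by omega), Submodule.mem_bot] at hw
      rw [hw, map_zero]
    · rw [neg_zero, evenFiltration_zero] at hw
      rw [evenFiltration_zero] at hv
      exact hF.Q_even hv hw
    · rw [evenFiltration_pos F hp, Submodule.mem_bot] at hv
      rw [hv, map_zero, LinearMap.zero_apply]
  pos := by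
    intro p v hv hv0
    rcases hodgePiece_evenFiltration F p with ⟨rfl, h1⟩ | ⟨rfl, h1⟩ | ⟨h0, h0', h1⟩
    · rw [h1] at hv
      simpa using hF.pos_even hv hv0
    · rw [h1, mem_conjSub] at hv
      have h2 := hF.pos_even hv (fun hc => hv0 (by rw [← conj_conj v, hc, map_zero]))
      rw [conj_conj, Q_swap] at h2
      have hI : Complex.I ^ ((-1 : ℤ) - (-(-1) - 1)) = -Complex.I := by
        norm_num
      rw [hI]
      simpa using h2
    · rw [h1, Submodule.mem_bot] at hv
      exact absurd hv hv0

end IsPolarizedHodge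

/-- The even map `D → 𝓗`, `F ↦ ⨁_{p even} H^{p,-p-1}`. -/
def evenMap (g : ℕ) (h : ℤ → ℕ) (F : Domain g h) : Siegel g :=
  ⟨evenFiltration F.1, F.2.even⟩

/-- The real symplectic group `Sp(g, ℝ)`, of `2g × 2g` matrices. -/
abbrev Sp (g : ℕ) : Type := Matrix.symplecticGroup (Fin g) ℝ

/-- The action of a real symplectic matrix on `H_ℂ`. -/
def spLin {g : ℕ} (γ : Sp g) : HC g →ₗ[ℂ] HC g :=
  Matrix.toEuclideanLin ((γ : Matrix (Fin g ⊕ Fin g) (Fin g ⊕ Fin g) ℝ).map Complex.ofReal)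

section action

variable {g : ℕ}

lemma spLin_one : spLin (1 : Sp g) = LinearMap.id := by
  simp [spLin]

lemma spLin_mul (γ δ : Sp g) : spLin (γ * δ) = spLin γ ∘ₗ spLin δ := by
  rw [spLin, spLin, spLin, ← Matrix.toLpLin_mul_same]
  congr 1
  exact Matrix.map_mul (f := Complex.ofRealHom)

lemma spLin_inv_apply (γ : Sp g) (v : HC g) : spLin γ⁻¹ (spLin γ v) = v := by
  rw [← LinearMap.comp_apply, ← spLin_mul, inv_mul_cancel, spLin_one, LinearMap.id_apply]

lemma spLin_apply_inv (γ : Sp g) (v : HC g) : spLin γ (spLin γ⁻¹ v) = v := by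
  rw [← LinearMap.comp_apply, ← spLin_mul, mul_inv_cancel, spLin_one, LinearMap.id_apply]

lemma spLin_injective (γ : Sp g) : Function.Injective (spLin γ) :=
  Function.LeftInverse.injective (spLin_inv_apply γ)

lemma spLin_surjective (γ : Sp g) : Function.Surjective (spLin γ) :=
  Function.RightInverse.surjective (spLin_apply_inv γ)

lemma conj_spLin (γ : Sp g) (v : HC g) : conj g (spLin γ v) = spLin γ (conj g v) := by
  ext i
  simp [spLin, Matrix.toLpLin_apply, Matrix.mulVec, dotProduct, map_sum]

lemma Q_spLin (γ : Sp g) (v w : HC g) : Q g (spLin γ v) (spLin γ w) = Q g v w := by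
  have hγ : (γ : Matrix (Fin g ⊕ Fin g) (Fin g ⊕ Fin g) ℝ).map Complex.ofRealHom ∈
      Matrix.symplecticGroup (Fin g) ℂ :=
    SymplecticGroup.map_mem γ.2 Complex.ofRealHom
  rw [SymplecticGroup.mem_iff'] at hγ
  have hJ : (Matrix.fromBlocks 0 1 (-1) 0 : Matrix (Fin g ⊕ Fin g) (Fin g ⊕ Fin g) ℂ)
      = -Matrix.J (Fin g) ℂ := by
    simp [Matrix.J, Matrix.fromBlocks_neg]
  have key : ∀ (M J : Matrix (Fin g ⊕ Fin g) (Fin g ⊕ Fin g) ℂ) (x y : Fin g ⊕ Fin g → ℂ),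
      Mᵀ * J * M = J → (M *ᵥ x) ⬝ᵥ (-J *ᵥ (M *ᵥ y)) = x ⬝ᵥ (-J *ᵥ y) := by
    intro M J x y hM
    rw [Matrix.neg_mulVec, Matrix.neg_mulVec, dotProduct_neg, dotProduct_neg]
    conv_rhs => rw [← hM, Matrix.mul_assoc, ← Matrix.mulVec_mulVec, Matrix.dotProduct_mulVec,
      Matrix.vecMul_transpose, ← Matrix.mulVec_mulVec]
  rw [Q_apply, Q_apply, hJ]
  exact key _ _ _ _ hγ

lemma mem_map_spLin (γ : Sp g) (V : Submodule ℂ (HC g)) (v : HC g) :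
    v ∈ V.map (spLin γ) ↔ spLin γ⁻¹ v ∈ V := by
  constructor
  · rintro ⟨w, hw, rfl⟩
    rwa [spLin_inv_apply]
  · intro hv
    exact ⟨_, hv, spLin_apply_inv γ v⟩

lemma conjSub_map (γ : Sp g) (V : Submodule ℂ (HC g)) :
    conjSub (V.map (spLin γ)) = (conjSub V).map (spLin γ) := by
  ext v
  rw [mem_conjSub, mem_map_spLin, mem_map_spLin, mem_conjSub, conj_spLin]

lemma hodgePiece_map (γ : Sp g) (F : ℤ → Submodule ℂ (HC g)) (p : ℤ) :
    hodgePiece (fun q => (F q).map (spLin γ)) p = (hodgePiece F p).map (spLin γ) := by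
  rw [hodgePiece, hodgePiece, conjSub_map, Submodule.map_inf _ (spLin_injective γ)]

lemma IsPolarizedHodge.map {h : ℤ → ℕ} {F : ℤ → Submodule ℂ (HC g)}
    (hF : IsPolarizedHodge g h F) (γ : Sp g) :
    IsPolarizedHodge g h (fun p => (F p).map (spLin γ)) where
  antitone := fun _ _ hpq => Submodule.map_mono (hF.antitone hpq)
  exhaustive := by
    obtain ⟨p, hp⟩ := hF.exhaustive
    exact ⟨p, by rw [hp, Submodule.map_top, LinearMap.range_eq_top]; exact spLin_surjective γ⟩
  separated := by
    obtain ⟨p, hp⟩ := hF.separated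
    exact ⟨p, by rw [hp, Submodule.map_bot]⟩
  isCompl := by
    intro p
    have := hF.isCompl p
    rw [conjSub_map]
    constructor
    · rw [disjoint_iff, ← Submodule.map_inf _ (spLin_injective γ), this.inf_eq_bot,
        Submodule.map_bot]
    · rw [codisjoint_iff, ← Submodule.map_sup, this.sup_eq_top, Submodule.map_top,
        LinearMap.range_eq_top]
      exact spLin_surjective γ
  finrank_piece := by
    intro p
    rw [hodgePiece_map, ← hF.finrank_piece p]
    exact (Submodule.equivMapOfInjective (spLin γ) (spLin_injective γ) _).finrank_eq.symm
  isotropic := by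
    rintro p _ ⟨v, hv, rfl⟩ _ ⟨w, hw, rfl⟩
    rw [Q_spLin]
    exact hF.isotropic p v hv w hw
  pos := by
    intro p v hv hv0
    rw [hodgePiece_map] at hv
    obtain ⟨u, hu, rfl⟩ := hv
    rw [conj_spLin, Q_spLin]
    exact hF.pos p u hu (fun hc => hv0 (by rw [hc, map_zero]))

/-- `Sp(g, ℝ)` acts on the period domain by `(γ F)^p = γ (F^p)`. -/
instance (h : ℤ → ℕ) : MulAction (Sp g) (Domain g h) where
  smul γ F := ⟨fun p => (F.1 p).map (spLin γ), F.2.map γ⟩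
  one_smul F := Subtype.ext (funext fun p => by
    change (F.1 p).map (spLin 1) = F.1 p
    rw [spLin_one, Submodule.map_id])
  mul_smul γ δ F := Subtype.ext (funext fun p => by
    change (F.1 p).map (spLin (γ * δ)) = ((F.1 p).map (spLin δ)).map (spLin γ)
    rw [spLin_mul, Submodule.map_comp])

lemma evenMap_smul (h : ℤ → ℕ) (γ : Sp g) (F : Domain g h) :
    evenMap g h (γ • F) = γ • evenMap g h F := by
  refine Subtype.ext (funext fun p => ?_)
  change evenFiltration (fun q => (F.1 q).map (spLin γ)) p
    = (evenFiltration F.1 p).map (spLin γ)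
  unfold evenFiltration
  split_ifs
  · rw [Submodule.map_top, eq_comm, LinearMap.range_eq_top]
    exact spLin_surjective γ
  · simp only [evenPart, hodgePiece_map, Submodule.map_iSup]
  · rw [Submodule.map_bot]

end action

/-- The quotient `Γ \ D`, with the quotient topology. -/
abbrev DomainQuotient {g : ℕ} (Γ : Subgroup (Sp g)) (h : ℤ → ℕ) : Type :=
  MulAction.orbitRel.Quotient Γ (Domain g h)

/-- The map `Γ \ D → Γ \ 𝓗` induced by the even map. -/
def evenMapQuot {g : ℕ} (Γ : Subgroup (Sp g)) (h : ℤ → ℕ) :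
    DomainQuotient Γ h → DomainQuotient Γ (siegelNumbers g) :=
  Quotient.map' (evenMap g h) (by
    rintro _ F ⟨γ, rfl⟩
    exact ⟨γ, (evenMap_smul h (γ : Sp g) F).symm⟩)

/-- The subgroup `Sp(g, ℤ)` of `Sp(g, ℝ)`. -/
def integralSp (g : ℕ) : Subgroup (Sp g) where
  carrier := {γ | ∃ A : Matrix (Fin g ⊕ Fin g) (Fin g ⊕ Fin g) ℤ,
    (γ : Matrix (Fin g ⊕ Fin g) (Fin g ⊕ Fin g) ℝ) = A.map (Int.castRingHom ℝ)}
  one_mem' := ⟨1, by simp⟩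
  mul_mem' := by
    rintro γ δ ⟨A, hA⟩ ⟨B, hB⟩
    exact ⟨A * B, by rw [Matrix.map_mul, ← hA, ← hB]; rfl⟩
  inv_mem' := by
    rintro γ ⟨A, hA⟩
    refine ⟨-(Matrix.J (Fin g) ℤ) * Aᵀ * Matrix.J (Fin g) ℤ, ?_⟩
    rw [SymplecticGroup.coe_inv, hA, Matrix.map_mul, Matrix.map_mul, Matrix.map_neg _ (map_neg _),
      Matrix.map_J, Matrix.transpose_map]

/-- Arithmetic subgroups of `Sp(g, ℝ)`. -/
def IsArithmetic {g : ℕ} (Γ : Subgroup (Sp g)) : Prop :=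
  Subgroup.Commensurable Γ (integralSp g)

/-- `Γ` is neat: for every `γ ∈ Γ` the subgroup of `ℂˣ` generated by the eigenvalues of `γ` is
torsion-free. -/
def IsNeat {g : ℕ} (Γ : Subgroup (Sp g)) : Prop :=
  ∀ γ ∈ Γ, ∀ z ∈ Subgroup.closure {z : ℂˣ | (z : ℂ) ∈
      spectrum ℂ ((γ : Matrix (Fin g ⊕ Fin g) (Fin g ⊕ Fin g) ℝ).map Complex.ofReal)},
    ∀ k : ℕ, 0 < k → z ^ k = 1 → z = 1

/-- Index set of size `∑_{p ≥ 0} h p`, partitioned into blocks of sizes `h p`, `p ≥ 0`. -/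
abbrev BlockIndex (h : ℤ →₀ ℕ) : Type :=
  Σ p : {p : ℤ // p ∈ h.support.filter (0 ≤ ·)}, Fin (h p.1)

/-- The block-diagonal embedding `∏_{p ≥ 0} U(h p) → U(∑_{p ≥ 0} h p)`. -/
def blockUnitary (h : ℤ →₀ ℕ) :
    (∀ p : {p : ℤ // p ∈ h.support.filter (0 ≤ ·)}, Matrix.unitaryGroup (Fin (h p.1)) ℂ) →*
      Matrix.unitaryGroup (BlockIndex h) ℂ where
  toFun u := ⟨Matrix.blockDiagonal' fun p => (u p : Matrix (Fin (h p.1)) (Fin (h p.1)) ℂ), by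
    rw [Matrix.mem_unitaryGroup_iff, Matrix.star_eq_conjTranspose,
      Matrix.blockDiagonal'_conjTranspose, ← Matrix.blockDiagonal'_mul,
      ← Matrix.blockDiagonal'_one]
    congr 1
    funext p
    exact Matrix.mem_unitaryGroup_iff.1 (u p).2⟩
  map_one' := Subtype.ext Matrix.blockDiagonal'_one
  map_mul' u v := Subtype.ext (Matrix.blockDiagonal'_mul
    (fun p => (u p : Matrix (Fin (h p.1)) (Fin (h p.1)) ℂ))
    (fun p => (v p : Matrix (Fin (h p.1)) (Fin (h p.1)) ℂ)))

/-- The space `U(g) / ∏_{p ≥ 0} U(h p)`, where `g = ∑_{p ≥ 0} h p`, with the quotient topology. -/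
abbrev FlagFiber (h : ℤ →₀ ℕ) : Type :=
  Matrix.unitaryGroup (BlockIndex h) ℂ ⧸ (blockUnitary h).range

end WeightNegOne

end

/-! A polarized Hodge structure F of weight -1 is encoded by a frame (`IsFrame`): a basis E of the
Lagrangian subspace W = ⨁_{p even} H^{p,-p-1}, orthonormal for the Hermitian form i Q(v, conj w),
which is positive definite on W, together with even integers t recording the Hodge types. The
vectors (E, conj E) form a basis of H_ℂ in which conj E_i has type -t_i - 1, and every condition on
F becomes a condition on coordinates. Every F comes from a frame (`exists_isFrame`), and the even
map only forgets the types (`IsFrame.evenFiltration_frameFlag`).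

Two frames of the same W differ by a unitary matrix (`IsFrame.exists_unitary`), and such a matrix
preserves F exactly when it is block diagonal (`IsFrame.frameFlag_frameMul_eq_iff`). So the fiber of
the even map is C'. Continuous frames exist locally on the Siegel space (`exists_local_frame`). Over
an open U carrying one they give a continuous bijection from U × C' to the preimage of U, which is a
homeomorphism because C' is compact (`isOpenEmbedding_flagFamily`).

An arithmetic group has only finitely many elements with entries below a given bound
(`IsArithmetic.finite_inter`). An element with bounded powers therefore has finite order, its
eigenvalues are roots of unity, and neatness makes it trivial (`eq_one_of_pow_mem`). This gives the
third claim. Applied to stabilizers of points of the Siegel space, it also gives each point a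
neighbourhood that no nontrivial element of Γ moves to meet itself (`exists_wandering_frame`), so
the local product structure descends to the quotients (`exists_trivialization`).

C' is Hausdorff because it injects continuously into matrices as the conjugation orbit of a diagonal
matrix. A chart at the base point is the exponential on small skew-Hermitian matrices with zero
diagonal blocks, obtained from the inverse function theorem (`exists_isOpenEmbedding_sliceFlag`);
the other charts are its translates by U(g), and the dimension is a count of off-diagonal entries.
-/

namespace WeightNegOne

/-! ### Continuity of orthogonal and oblique projections -/

section Projections

variable {E : Type*} [NormedAddCommGroup E] [InnerProductSpace ℂ E] [FiniteDimensional ℂ E]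
  {X : Type*} [TopologicalSpace X]

lemma isUnit_of_forall_eq_zero {f : E →L[ℂ] E} (hf : ∀ x, f x = 0 → x = 0) : IsUnit f := by
  rw [ContinuousLinearMap.isUnit_iff_isUnit_toLinearMap, LinearMap.isUnit_iff_ker_eq_bot,
    LinearMap.ker_eq_bot']
  exact hf

/-- For T = R - R* one has (R + R* - 1)² = 1 + T* T, which is positive definite; so the operator is
injective, hence invertible in finite dimension. -/
lemma isUnit_add_star_sub_one {R : E →L[ℂ] E} (hR : R * R = R) : IsUnit (R + star R - 1) := by
  refine isUnit_of_forall_eq_zero fun x hx => ?_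
  have hR' : star R * star R = star R := by rw [← star_mul, hR]
  have key : (R + star R - 1) * (R + star R - 1) = 1 + star (R - star R) * (R - star R) := by
    rw [star_sub, star_star]
    have e1 : (R + star R - 1) * (R + star R - 1) =
        R * R + star R * star R + R * star R + star R * R - R - R - star R - star R + 1 := by
      noncomm_ring
    have e2 : 1 + (star R - R) * (R - star R) =
        1 + star R * R - star R * star R - R * R + R * star R := by noncomm_ring
    rw [e1, e2, hR, hR']
    abel
  have h1 : (1 + star (R - star R) * (R - star R)) x = 0 := by
    rw [← key, mul_apply_eq_comp, hx, map_zero]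
  have h2 : inner ℂ ((1 + star (R - star R) * (R - star R)) x) x = (0 : ℂ) := by
    rw [h1, inner_zero_left]
  rw [_root_.add_apply, mul_apply_eq_comp, inner_add_left,
    ContinuousLinearMap.star_eq_adjoint, ContinuousLinearMap.adjoint_inner_left,
    one_apply_eq_self, inner_self_eq_norm_sq_to_K, inner_self_eq_norm_sq_to_K] at h2
  have h3 : ‖x‖ ^ 2 + ‖(R - star R) x‖ ^ 2 = 0 :=
    (RCLike.ofReal_eq_zero (K := ℂ)).1 (by push_cast; exact h2)
  have : ‖x‖ ^ 2 = 0 := by nlinarith [sq_nonneg ‖x‖, sq_nonneg ‖(R - star R) x‖]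
  simpa using this

lemma continuous_ringInverse {A : Type*} [NormedRing A] [HasSummableGeomSeries A] {f : X → A}
    (hf : Continuous f) (hu : ∀ x, IsUnit (f x)) : Continuous fun x => Ring.inverse (f x) := by
  rw [continuous_iff_continuousAt]
  intro x
  obtain ⟨u, hux⟩ := hu x
  have h := NormedRing.inverse_continuousAt u
  rw [hux] at h
  exact ContinuousAt.comp (f := f) h hf.continuousAt

/-- The orthogonal projection onto the range of an idempotent depends continuously on it. -/
lemma continuous_starProjection {R : X → E →L[ℂ] E} (hR : Continuous R)
    {V : X → Submodule ℂ E} (hmem : ∀ x v, R x v ∈ V x) (hid : ∀ x, ∀ v ∈ V x, R x v = v) :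
    Continuous fun x => ((V x).starProjection : E →L[ℂ] E) := by
  have hRR : ∀ x, R x * R x = R x := fun x =>
    ContinuousLinearMap.ext fun v => hid x _ (hmem x v)
  -- With P the orthogonal projection, P R = R, and P R* = P is the adjoint of R P = P. Hence P (R +
  -- R* - 1) = R, which is solved for P.
  have key : ∀ x, ((V x).starProjection : E →L[ℂ] E) =
      R x * Ring.inverse (R x + star (R x) - 1) := by
    intro x
    have h1 : (V x).starProjection * R x = R x := ContinuousLinearMap.ext fun v =>
      Submodule.starProjection_eq_self_iff.2 (hmem x v)
    have h2 : R x * (V x).starProjection = (V x).starProjection :=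
      ContinuousLinearMap.ext fun v => hid x _ (Submodule.starProjection_apply_mem _ _)
    have hs : star ((V x).starProjection : E →L[ℂ] E) = (V x).starProjection :=
      (isSelfAdjoint_starProjection (V x)).star_eq
    have h3 : (V x).starProjection * star (R x) = (V x).starProjection := by
      rw [← hs, ← star_mul, h2]
    have h4 : (V x).starProjection * (R x + star (R x) - 1) = R x := by
      rw [mul_sub, mul_add, h1, h3, mul_one, add_sub_cancel_right]
    rw [← h4, mul_assoc, h4, Ring.mul_inverse_cancel _ (isUnit_add_star_sub_one (hRR x)), mul_one]
  simp_rw [key]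
  exact hR.mul (continuous_ringInverse ((hR.add hR.star).sub continuous_const)
    fun x => isUnit_add_star_sub_one (hRR x))

/-- The projection onto a subspace along a complement depends continuously on both. -/
lemma continuous_oblique {V W : X → Submodule ℂ E} (hVW : ∀ x, IsCompl (V x) (W x))
    (hV : Continuous fun x => ((V x).starProjection : E →L[ℂ] E))
    (hW : Continuous fun x => ((W x).starProjection : E →L[ℂ] E))
    {R : X → E →L[ℂ] E} (hRV : ∀ x, ∀ v ∈ V x, R x v = v) (hRW : ∀ x, ∀ v ∈ W x, R x v = 0) :
    Continuous R := by
  -- If P_V v = P_W v, this vector lies in V ∩ W = 0, so v is orthogonal to V + W, which is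
  -- everything.
  have hu : ∀ x, IsUnit ((V x).starProjection - (W x).starProjection : E →L[ℂ] E) := by
    refine fun x => isUnit_of_forall_eq_zero fun v hv => ?_
    have h1 : (V x).starProjection v = (W x).starProjection v := sub_eq_zero.1 hv
    have h2 : (V x).starProjection v = 0 :=
      Submodule.disjoint_def.1 (hVW x).disjoint _ (Submodule.starProjection_apply_mem _ _)
        (h1 ▸ Submodule.starProjection_apply_mem _ _)
    have h3 : v ∈ (V x)ᗮ := (Submodule.starProjection_apply_eq_zero_iff _).1 h2
    have h4 : v ∈ (W x)ᗮ := (Submodule.starProjection_apply_eq_zero_iff _).1 (h1 ▸ h2)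
    have h5 : v ∈ (V x ⊔ W x)ᗮ := by
      rw [← Submodule.inf_orthogonal]
      exact ⟨h3, h4⟩
    rwa [(hVW x).sup_eq_top, Submodule.top_orthogonal_eq_bot, Submodule.mem_bot] at h5
  have key : ∀ x, R x = (V x).starProjection *
      Ring.inverse ((V x).starProjection - (W x).starProjection) := by
    intro x
    have h1 : R x * (V x).starProjection = (V x).starProjection :=
      ContinuousLinearMap.ext fun v => hRV x _ (Submodule.starProjection_apply_mem _ _)
    have h2 : R x * (W x).starProjection = 0 :=
      ContinuousLinearMap.ext fun v => hRW x _ (Submodule.starProjection_apply_mem _ _)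
    have h3 : R x * ((V x).starProjection - (W x).starProjection) = (V x).starProjection := by
      rw [mul_sub, h1, h2, sub_zero]
    rw [← h3, mul_assoc, h3, Ring.mul_inverse_cancel _ (hu x), mul_one]
  rw [show R = _ from funext key]
  exact hV.mul (continuous_ringInverse (hV.sub hW) hu)

lemma starProjection_injective {V W : Submodule ℂ E}
    (hVW : (V.starProjection : E →L[ℂ] E) = W.starProjection) : V = W := by
  ext v
  rw [← Submodule.starProjection_eq_self_iff, hVW, Submodule.starProjection_eq_self_iff]

end Projections

/-! ### Frames of Lagrangian subspaces and the Hodge structures they define -/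

section Frames

variable {g : ℕ} {ι : Type*}

/-- The family `(E, conj E)`. -/
def frameBasis (E : ι → HC g) : ι ⊕ ι → HC g := Sum.elim E fun i => conj g (E i)

/-- The coordinates with respect to the basis `(E, conj E)` of a frame `E`. -/
noncomputable def frameCoord (E : ι → HC g) : ι ⊕ ι → HC g →ₗ[ℂ] ℂ :=
  Sum.elim (fun i => Complex.I • (Q g).flip (conj g (E i))) fun i => -Complex.I • (Q g).flip (E i)

/-- The Hodge types of the basis `(E, conj E)`, if those of `E` are `t`. -/
def frameType (t : ι → ℤ) : ι ⊕ ι → ℤ := Sum.elim t fun i => -t i - 1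

@[simp] lemma frameBasis_inl (E : ι → HC g) (i : ι) : frameBasis E (.inl i) = E i := rfl

@[simp] lemma frameBasis_inr (E : ι → HC g) (i : ι) :
    frameBasis E (.inr i) = conj g (E i) := rfl

lemma frameCoord_inl (E : ι → HC g) (i : ι) (v : HC g) :
    frameCoord E (.inl i) v = Complex.I * Q g v (conj g (E i)) := rfl

lemma frameCoord_inr (E : ι → HC g) (i : ι) (v : HC g) :
    frameCoord E (.inr i) v = -Complex.I * Q g v (E i) := rfl

@[simp] lemma frameType_inl (t : ι → ℤ) (i : ι) : frameType t (.inl i) = t i := rfl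

@[simp] lemma frameType_inr (t : ι → ℤ) (i : ι) : frameType t (.inr i) = -t i - 1 := rfl

lemma frameType_swap (t : ι → ℤ) (k : ι ⊕ ι) : frameType t k.swap = -frameType t k - 1 := by
  rcases k with i | i <;> simp

lemma frameCoord_conj (E : ι → HC g) (k : ι ⊕ ι) (v : HC g) :
    frameCoord E k (conj g v) = starRingEnd ℂ (frameCoord E k.swap v) := by
  rcases k with i | i
  · rw [Sum.swap_inl, frameCoord_inl, frameCoord_inr, Q_conj, map_mul, map_neg, Complex.conj_I,
      neg_neg]
  · rw [Sum.swap_inr, frameCoord_inl, frameCoord_inr, map_mul, ← Q_conj, conj_conj,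
      Complex.conj_I]

lemma frameCoord_eq_zero_of_Q (E : ι → HC g) (k : ι ⊕ ι) (v : HC g)
    (hv : Q g v (frameBasis E k.swap) = 0) :
    frameCoord E k v = 0 := by
  rcases k with i | i
  · rw [frameCoord_inl, show Q g v (conj g (E i)) = 0 from hv, mul_zero]
  · rw [frameCoord_inr, show Q g v (E i) = 0 from hv, mul_zero]

/-- The filtration spanned by the basis vectors of types `≥ p`. -/
noncomputable def frameFlag (t : ι → ℤ) (E : ι → HC g) (p : ℤ) : Submodule ℂ (HC g) :=
  ⨅ k : {k // frameType t k < p}, LinearMap.ker (frameCoord E k.1)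

/-- Cutting out the filtration by vanishing coordinates, rather than as a span, reduces every
membership question below to one about coordinates. -/
lemma mem_frameFlag {t : ι → ℤ} {E : ι → HC g} {p : ℤ} {v : HC g} :
    v ∈ frameFlag t E p ↔ ∀ k, frameType t k < p → frameCoord E k v = 0 := by
  simp [frameFlag, Submodule.mem_iInf]

/-- Conjugation exchanges the types q and -q-1, so the types < p turn into the types ≥ -p. -/
lemma mem_conjSub_frameFlag {t : ι → ℤ} {E : ι → HC g} {p : ℤ} {v : HC g} :
    v ∈ conjSub (frameFlag t E p) ↔ ∀ k, -p ≤ frameType t k → frameCoord E k v = 0 := by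
  rw [mem_conjSub, mem_frameFlag]
  constructor
  · intro hv k hk
    have := hv k.swap (by rw [frameType_swap]; omega)
    rwa [frameCoord_conj, Sum.swap_swap, map_eq_zero] at this
  · intro hv k hk
    rw [frameCoord_conj, hv k.swap (by rw [frameType_swap]; omega), map_zero]

lemma mem_hodgePiece_frameFlag {t : ι → ℤ} {E : ι → HC g} {p : ℤ} {v : HC g} :
    v ∈ hodgePiece (frameFlag t E) p ↔ ∀ k, frameType t k ≠ p → frameCoord E k v = 0 := by
  rw [hodgePiece, Submodule.mem_inf, mem_frameFlag, mem_conjSub_frameFlag]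
  constructor
  · rintro ⟨h1, h2⟩ k hk
    rcases lt_or_gt_of_ne hk with h | h
    · exact h1 k h
    · exact h2 k (by omega)
  · exact fun h => ⟨fun k hk => h k hk.ne, fun k hk => h k (by omega)⟩

variable [Fintype ι] [DecidableEq ι]

/-- A family of `g` vectors of `H_ℂ` which is isotropic for `Q` and orthonormal for the Hermitian
form `i Q(v, conj w)`. -/
structure IsFrame (E : ι → HC g) : Prop where
  card_eq : Fintype.card ι = g
  isotropic : ∀ i j, Q g (E i) (E j) = 0
  orthonormal : ∀ i j, Q g (E i) (conj g (E j)) = if i = j then -Complex.I else 0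

namespace IsFrame

variable {E : ι → HC g}

/-- The coordinates are dual to (E, conj E): the four cases are the isotropy and orthonormality
relations and their conjugates. -/
lemma frameCoord_frameBasis (hE : IsFrame E) (k l : ι ⊕ ι) :
    frameCoord E k (frameBasis E l) = if k = l then 1 else 0 := by
  rcases k with i | i <;> rcases l with j | j
  · simp [frameCoord_inl, hE.orthonormal, eq_comm]
  · simp [frameCoord_inl, Q_conj, hE.isotropic]
  · simp [frameCoord_inr, hE.isotropic]
  · rw [frameCoord_inr, frameBasis_inr, ← conj_conj (E i), Q_conj, hE.orthonormal]
    by_cases hij : i = j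
    · simp [hij]
    · simp [hij, Ne.symm hij]

lemma linearIndependent (hE : IsFrame E) : LinearIndependent ℂ (frameBasis E) := by
  rw [Fintype.linearIndependent_iff]
  intro c hc k
  have := congrArg (frameCoord E k) hc
  simpa [map_sum, hE.frameCoord_frameBasis, -Fintype.sum_sum_type] using this

lemma sum_frameCoord (hE : IsFrame E) (v : HC g) :
    ∑ k, frameCoord E k v • frameBasis E k = v := by
  have hspan : ⊤ ≤ Submodule.span ℂ (Set.range (frameBasis E)) := by
    rw [hE.linearIndependent.span_eq_top_of_card_eq_finrank' (by simp [hE.card_eq])]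
  have hv : v ∈ Submodule.span ℂ (Set.range (frameBasis E)) := hspan trivial
  obtain ⟨c, rfl⟩ := (Submodule.mem_span_range_iff_exists_fun ℂ).1 hv
  refine Finset.sum_congr rfl fun k _ => ?_
  simp [map_sum, hE.frameCoord_frameBasis, -Fintype.sum_sum_type]

lemma Q_eq (hE : IsFrame E) (v w : HC g) :
    Q g v w = -Complex.I * ∑ i, (frameCoord E (.inl i) v * frameCoord E (.inr i) w -
      frameCoord E (.inr i) v * frameCoord E (.inl i) w) := by
  conv_lhs => rw [← hE.sum_frameCoord w]
  rw [map_sum, Fintype.sum_sum_type, ← Finset.sum_add_distrib, Finset.mul_sum]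
  refine Finset.sum_congr rfl fun i _ => ?_
  have h1 : Q g v (conj g (E i)) = -Complex.I * frameCoord E (.inl i) v := by
    rw [frameCoord_inl, ← mul_assoc]
    simp
  have h2 : Q g v (E i) = Complex.I * frameCoord E (.inr i) v := by
    rw [frameCoord_inr, ← mul_assoc]
    simp
  rw [map_smul, map_smul, frameBasis_inl, frameBasis_inr, h1, h2, smul_eq_mul, smul_eq_mul]
  ring

/-- The form i Q(v, conj v) is diagonal in the frame, positive on E and negative on conj E; all
positivity arguments rest on this. -/
lemma Q_conj_eq (hE : IsFrame E) (v : HC g) :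
    Q g v (conj g v) = -Complex.I * ((∑ i, (‖frameCoord E (.inl i) v‖ ^ 2 -
      ‖frameCoord E (.inr i) v‖ ^ 2) : ℝ) : ℂ) := by
  rw [hE.Q_eq]
  congr 1
  push_cast
  refine Finset.sum_congr rfl fun i _ => ?_
  rw [frameCoord_conj, frameCoord_conj, Sum.swap_inl, Sum.swap_inr, Complex.mul_conj',
    Complex.mul_conj']

lemma frameCoord_eq_zero (hE : IsFrame E) {v : HC g} (hv : ∀ k, frameCoord E k v = 0) : v = 0 := by
  rw [← hE.sum_frameCoord v]
  simp [hv]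

lemma frameBasis_mem_hodgePiece (hE : IsFrame E) (t : ι → ℤ) (k : ι ⊕ ι) :
    frameBasis E k ∈ hodgePiece (frameFlag t E) (frameType t k) := by
  rw [mem_hodgePiece_frameFlag]
  intro l hl
  rw [hE.frameCoord_frameBasis, if_neg]
  rintro rfl
  exact hl rfl

/-- As all t_i are even, the conjugate vectors have odd types, so the even part is exactly the span
of E. -/
lemma mem_evenPart (hE : IsFrame E) {t : ι → ℤ} (ht : ∀ i, Even (t i)) {v : HC g} :
    v ∈ evenPart (frameFlag t E) ↔ ∀ i, frameCoord E (.inr i) v = 0 := by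
  constructor
  · intro hv
    refine Submodule.iSup_induction _ (motive := fun v => ∀ i, frameCoord E (.inr i) v = 0) hv
      ?_ (by simp) ?_
    · intro k v hv i
      refine mem_hodgePiece_frameFlag.1 hv _ ?_
      obtain ⟨m, hm⟩ := ht i
      rw [frameType_inr]
      omega
    · intro x y hx hy i
      rw [map_add, hx, hy, add_zero]
  · intro hv
    rw [← hE.sum_frameCoord v]
    refine Submodule.sum_mem _ ?_
    rintro (i | i) -
    · refine Submodule.smul_mem _ _ ?_
      obtain ⟨m, hm⟩ := ht i
      refine le_iSup (fun k : ℤ => hodgePiece (frameFlag t E) (2 * k)) m ?_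
      rw [two_mul, ← hm]
      exact hE.frameBasis_mem_hodgePiece t (.inl i)
    · rw [hv, zero_smul]
      exact zero_mem _

lemma evenFiltration_frameFlag (hE : IsFrame E) {t : ι → ℤ} (ht : ∀ i, Even (t i)) :
    evenFiltration (frameFlag t E) = frameFlag (fun _ => 0) E := by
  funext p
  ext v
  rw [mem_frameFlag]
  rcases lt_trichotomy p 0 with hp | rfl | hp
  · rw [evenFiltration_neg _ hp]
    refine iff_of_true trivial ?_
    rintro (i | i) hi
    · simp only [frameType_inl] at hi
      omega
    · simp only [frameType_inr] at hi
      omega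
  · rw [evenFiltration_zero, hE.mem_evenPart ht]
    constructor
    · rintro hv (i | i) hi
      · simp at hi
      · exact hv i
    · exact fun hv i => hv _ (by simp)
  · rw [evenFiltration_pos _ hp, Submodule.mem_bot]
    constructor
    · rintro rfl k -
      exact map_zero _
    · intro hv
      refine hE.frameCoord_eq_zero ?_
      rintro (i | i)
      · exact hv _ (by simpa using hp)
      · exact hv _ (by rw [frameType_inr]; omega)

end IsFrame

/-- The types `t` are even and are those of a frame of the even part of a Hodge structure with
Hodge numbers `h`. -/
structure IsHodgeType (h : ℤ → ℕ) (t : ι → ℤ) : Prop where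
  even : ∀ i, Even (t i)
  card : ∀ p, Even p → Fintype.card {i // t i = p} = h p
  symm : ∀ p, h (-p - 1) = h p

namespace IsFrame

variable {E : ι → HC g} {h : ℤ → ℕ} {t : ι → ℤ}

/-- In even degree q the piece has basis the E_i of type q; odd degrees follow by conjugation and
the symmetry of `h`. -/
lemma finrank_hodgePiece (hE : IsFrame E) (ht : IsHodgeType h t) (p : ℤ) :
    finrank ℂ (hodgePiece (frameFlag t E) p) = h p := by
  have key : ∀ q, Even q → finrank ℂ (hodgePiece (frameFlag t E) q) = h q := by
    intro q hq
    have hspan : hodgePiece (frameFlag t E) q =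
        Submodule.span ℂ (Set.range fun i : {i // t i = q} => E i.1) := by
      apply le_antisymm
      · intro v hv
        rw [mem_hodgePiece_frameFlag] at hv
        rw [← hE.sum_frameCoord v]
        refine Submodule.sum_mem _ ?_
        rintro (i | i) -
        · by_cases hi : t i = q
          · exact Submodule.smul_mem _ _ (Submodule.subset_span ⟨⟨i, hi⟩, rfl⟩)
          · rw [hv (.inl i) hi, zero_smul]
            exact zero_mem _
        · rw [hv (.inr i), zero_smul]
          · exact zero_mem _
          · obtain ⟨a, ha⟩ := ht.even i
            obtain ⟨b, hb⟩ := hq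
            rw [frameType_inr]
            omega
      · rw [Submodule.span_le]
        rintro _ ⟨⟨i, rfl⟩, rfl⟩
        exact hE.frameBasis_mem_hodgePiece t (.inl i)
    have hli : LinearIndependent ℂ fun i : {i // t i = q} => E i.1 :=
      hE.linearIndependent.comp (fun i : {i // t i = q} => Sum.inl i.1)
        fun i j hij => Subtype.ext (Sum.inl_injective hij)
    rw [hspan, finrank_span_eq_card hli, ht.card q hq]
  by_cases hp : Even p
  · exact key p hp
  · have h1 : hodgePiece (frameFlag t E) p = conjSub (hodgePiece (frameFlag t E) (-p - 1)) := by
      ext v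
      rw [mem_conjSub, conj_mem_hodgePiece_iff rfl]
    rw [h1, finrank_conjSub, key _ (by rw [Int.even_sub_one, even_neg]; exact hp), ht.symm]

lemma isPolarizedHodge (hE : IsFrame E) (ht : IsHodgeType h t) :
    IsPolarizedHodge g h (frameFlag t E) where
  antitone := by
    intro p q hpq v hv
    rw [mem_frameFlag] at hv ⊢
    exact fun k hk => hv k (hk.trans_le hpq)
  exhaustive := by
    obtain ⟨m, hm⟩ := (Set.finite_range (frameType t)).bddBelow
    refine ⟨m, eq_top_iff.2 fun v _ => mem_frameFlag.2 fun k hk => ?_⟩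
    exact absurd (hm ⟨k, rfl⟩) (not_le.2 hk)
  separated := by
    obtain ⟨m, hm⟩ := (Set.finite_range (frameType t)).bddAbove
    refine ⟨m + 1, eq_bot_iff.2 fun v hv => ?_⟩
    rw [mem_frameFlag] at hv
    exact hE.frameCoord_eq_zero fun k => hv k (Int.lt_add_one_iff.2 (hm ⟨k, rfl⟩))
  isCompl := by
    intro p
    constructor
    · rw [Submodule.disjoint_def]
      intro v h1 h2
      rw [mem_frameFlag] at h1
      rw [mem_conjSub_frameFlag, neg_neg] at h2
      refine hE.frameCoord_eq_zero fun k => ?_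
      rcases lt_or_ge (frameType t k) p with hk | hk
      · exact h1 k hk
      · exact h2 k hk
    · rw [codisjoint_iff, eq_top_iff]
      intro v _
      rw [← hE.sum_frameCoord v]
      refine Submodule.sum_mem _ fun k _ => Submodule.smul_mem _ _ ?_
      rcases lt_or_ge (frameType t k) p with hk | hk
      · refine Submodule.mem_sup_right (mem_conjSub_frameFlag.2 fun l hl => ?_)
        rw [hE.frameCoord_frameBasis, if_neg]
        rintro rfl
        omega
      · refine Submodule.mem_sup_left (mem_frameFlag.2 fun l hl => ?_)
        rw [hE.frameCoord_frameBasis, if_neg]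
        rintro rfl
        omega
  finrank_piece := hE.finrank_hodgePiece ht
  isotropic := by
    intro p v hv w hw
    rw [mem_frameFlag] at hv hw
    rw [hE.Q_eq, Finset.sum_eq_zero, mul_zero]
    intro i _
    have h1 : frameCoord E (.inl i) v * frameCoord E (.inr i) w = 0 := by
      rcases lt_or_ge (t i) p with hk | hk
      · rw [hv (.inl i) hk, zero_mul]
      · rw [hw (.inr i) (by rw [frameType_inr]; omega), mul_zero]
    have h2 : frameCoord E (.inr i) v * frameCoord E (.inl i) w = 0 := by
      rcases lt_or_ge (t i) (-p) with hk | hk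
      · rw [hw (.inl i) hk, mul_zero]
      · rw [hv (.inr i) (by rw [frameType_inr]; omega), zero_mul]
    rw [h1, h2, sub_zero]
  pos := by
    intro p v hv hv0
    rw [mem_hodgePiece_frameFlag] at hv
    have hpos : 0 < ∑ k, ‖frameCoord E k v‖ ^ 2 := by
      obtain ⟨k, hk⟩ : ∃ k, frameCoord E k v ≠ 0 := by
        by_contra! hc
        exact hv0 (hE.frameCoord_eq_zero hc)
      exact Finset.sum_pos' (fun _ _ => sq_nonneg _) ⟨k, Finset.mem_univ _, by positivity⟩
    rw [Fintype.sum_sum_type] at hpos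
    rw [hE.Q_conj_eq, Finset.sum_sub_distrib]
    have hI4 : Complex.I ^ (4 : ℤ) = 1 := by exact_mod_cast Complex.I_pow_four
    -- The parity of p fixes both signs at once: i^{2p+1} is i or -i, and only the coordinates along
    -- E, respectively along conj E, survive on the piece.
    obtain ⟨m, rfl | rfl⟩ := Int.even_or_odd' p
    · have hI : Complex.I ^ (2 * m - (-(2 * m) - 1)) = Complex.I := by
        rw [show 2 * m - (-(2 * m) - 1) = 4 * m + 1 by ring, zpow_add₀ Complex.I_ne_zero, zpow_mul,
          hI4]
        simp
      have h0 : ∑ i, ‖frameCoord E (.inr i) v‖ ^ 2 = 0 := Finset.sum_eq_zero fun i _ => by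
        obtain ⟨a, ha⟩ := ht.even i
        rw [hv (.inr i) (by rw [frameType_inr]; omega)]
        simp
      rw [h0, add_zero] at hpos
      rw [hI, h0, sub_zero, ← mul_assoc, mul_neg, Complex.I_mul_I, neg_neg, one_mul,
        Complex.ofReal_re]
      exact hpos
    · have hI : Complex.I ^ (2 * m + 1 - (-(2 * m + 1) - 1)) = -Complex.I := by
        rw [show 2 * m + 1 - (-(2 * m + 1) - 1) = 4 * m + 3 by ring,
          zpow_add₀ Complex.I_ne_zero, zpow_mul, hI4, one_zpow, one_mul]
        exact_mod_cast Complex.I_pow_three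
      have h0 : ∑ i, ‖frameCoord E (.inl i) v‖ ^ 2 = 0 := Finset.sum_eq_zero fun i _ => by
        obtain ⟨a, ha⟩ := ht.even i
        rw [hv (.inl i) (by rw [frameType_inl]; omega)]
        simp
      rw [h0, zero_add] at hpos
      rw [hI, h0, zero_sub, ← mul_assoc, neg_mul_neg, Complex.I_mul_I, neg_one_mul,
        Complex.neg_re, Complex.ofReal_re, neg_neg]
      exact hpos

end IsFrame

end Frames

/-! ### Existence of frames, and the action of unitary and symplectic matrices on them -/

section FrameExistence

variable {g : ℕ} {ι : Type*}

lemma star_hermitian (v w : HC g) :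
    starRingEnd ℂ (Complex.I * Q g v (conj g w)) = Complex.I * Q g w (conj g v) := by
  rw [map_mul, Complex.conj_I, ← Q_conj, conj_conj, Q_swap]
  ring

/-- Stated for an abstract `W` without a norm, so that the new inner product does not clash with the
Euclidean one that a subspace of `HC g` already carries. -/
lemma exists_orthonormal_of_core {W κ : Type*} [AddCommGroup W] [Module ℂ W]
    [FiniteDimensional ℂ W] [Fintype κ] [DecidableEq κ] (core : InnerProductSpace.Core ℂ W)
    (hκ : Fintype.card κ = finrank ℂ W) :
    ∃ b : κ → W, ∀ i j, core.inner (b i) (b j) = if i = j then 1 else 0 := by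
  let : NormedAddCommGroup W := core.toNormedAddCommGroup
  let : InnerProductSpace ℂ W := InnerProductSpace.ofCore core.toCore
  let b := (stdOrthonormalBasis ℂ W).reindex (Fintype.equivOfCardEq (by simp [hκ]) : _ ≃ κ)
  exact ⟨b, orthonormal_iff_ite.1 b.orthonormal⟩

lemma exists_orthonormal {κ : Type*} [Fintype κ] [DecidableEq κ] (V : Submodule ℂ (HC g))
    (hV : ∀ v ∈ V, v ≠ 0 → 0 < (Complex.I * Q g v (conj g v)).re)
    (hκ : Fintype.card κ = finrank ℂ V) :
    ∃ e : κ → HC g, (∀ i, e i ∈ V) ∧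
      ∀ i j, Q g (e i) (conj g (e j)) = if i = j then -Complex.I else 0 := by
  let core : InnerProductSpace.Core ℂ V :=
    -- The arguments are swapped because inner products are conjugate-linear in the first variable.
    { inner := fun x y => Complex.I * Q g y (conj g x)
      conj_inner_symm := fun x y => star_hermitian _ _
      re_inner_nonneg := fun x => by
        by_cases hx : (x : HC g) = 0
        · simp [hx]
        · exact (hV x x.2 hx).le
      add_left := fun x y z => by simp [mul_add]
      smul_left := fun x y r => by simp; ring
      definite := fun x hx => by
        by_contra hx0
        have := hV x x.2 (fun hc => hx0 (Subtype.ext hc))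
        rw [hx] at this
        simp at this }
  obtain ⟨b, hb⟩ := exists_orthonormal_of_core core hκ
  refine ⟨fun i => b i, fun i => (b i).2, fun i j => ?_⟩
  have h2 : Complex.I * Q g (b i) (conj g (b j)) = if j = i then 1 else 0 := hb j i
  calc Q g (b i) (conj g (b j)) = -Complex.I * (Complex.I * Q g (b i) (conj g (b j))) := by
        rw [← mul_assoc]; simp
    _ = _ := by
        rw [h2]
        by_cases hij : i = j
        · simp [hij]
        · simp [hij, Ne.symm hij]

variable [Fintype ι] [DecidableEq ι]

/-- Orthonormal bases of the even Hodge pieces are put together: distinct even pieces are orthogonal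
for the Hermitian form, and all of them are mutually isotropic because the sum of two even degrees
is never -1. -/
lemma exists_isFrame {h : ℤ → ℕ} {t : ι → ℤ} (ht : IsHodgeType h t) (hι : Fintype.card ι = g)
    {F : ℤ → Submodule ℂ (HC g)} (hF : IsPolarizedHodge g h F) :
    ∃ E : ι → HC g, IsFrame E ∧ F = frameFlag t E := by
  have hex : ∀ p, ∃ e : {i // t i = p} → HC g, (∀ i, e i ∈ hodgePiece F p) ∧
      ∀ i j, Q g (e i) (conj g (e j)) = if i = j then -Complex.I else 0 := by
    intro p
    by_cases hp : Even p
    · refine exists_orthonormal (hodgePiece F p) (fun v hv hv0 => hF.pos_even ?_ hv0) ?_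
      · obtain ⟨m, rfl⟩ := hp
        rw [← two_mul] at hv
        exact le_iSup (fun k : ℤ => hodgePiece F (2 * k)) m hv
      · rw [hF.finrank_piece, ht.card p hp]
    -- For odd p the index set is empty.
    · exact ⟨fun _ => 0, fun i => absurd (i.2 ▸ ht.even i) hp, fun i => absurd (i.2 ▸ ht.even i) hp⟩
  choose b hb hbo using hex
  let E : ι → HC g := fun i => b (t i) ⟨i, rfl⟩
  have hEb : ∀ p i (hi : t i = p), E i = b p ⟨i, hi⟩ := by
    rintro _ i rfl
    rfl
  have hmem : ∀ i, E i ∈ hodgePiece F (t i) := fun i => hb _ _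
  have hE : IsFrame E := by
    refine ⟨hι, fun i j => ?_, fun i j => ?_⟩
    · refine hF.Q_eq_zero ?_ (hmem i) (hmem j)
      obtain ⟨a, ha⟩ := ht.even i
      obtain ⟨c, hc⟩ := ht.even j
      omega
    · by_cases hij : t i = t j
      · rw [hEb (t j) i hij, hEb (t j) j rfl, hbo]
        simp
      · rw [if_neg (fun hc => hij (congrArg t hc))]
        exact hF.Q_eq_zero (q := -t j - 1) (by omega) (hmem i) (mem_hodgePiece_conj rfl (hmem j))
  have hbasis : ∀ k, frameBasis E k ∈ F (frameType t k) := by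
    rintro (i | i)
    · exact (hmem i).1
    · exact (mem_hodgePiece_conj rfl (hmem i)).1
  refine ⟨E, hE, funext fun p => le_antisymm (fun v hv => ?_) fun v hv => ?_⟩
  · rw [mem_frameFlag]
    -- A coordinate of type < p is, up to a constant, the pairing with a basis vector of type ≥ -p,
    -- which lies in F^{-p} and so pairs to zero with F^p.
    refine fun k hk => frameCoord_eq_zero_of_Q E k v (hF.isotropic p v hv _ (hF.antitone ?_ (hbasis _)))
    rw [frameType_swap]
    omega
  · rw [mem_frameFlag] at hv
    rw [← hE.sum_frameCoord v]
    refine Submodule.sum_mem _ fun k _ => ?_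
    rcases lt_or_ge (frameType t k) p with hk | hk
    · rw [hv k hk, zero_smul]
      exact zero_mem _
    · exact Submodule.smul_mem _ _ (hF.antitone hk (hbasis k))

/-- The family `E · u`, for a square matrix `u`. -/
noncomputable def frameMul (E : ι → HC g) (u : Matrix ι ι ℂ) : ι → HC g := fun i => ∑ j, u j i • E j

omit [DecidableEq ι] in
lemma frameMul_mul (E : ι → HC g) (u w : Matrix ι ι ℂ) :
    frameMul E (u * w) = frameMul (frameMul E u) w := by
  funext i
  simp only [frameMul, Matrix.mul_apply, Finset.sum_smul, Finset.smul_sum, smul_smul]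
  rw [Finset.sum_comm]
  simp only [mul_comm]

lemma frameMul_one (E : ι → HC g) : frameMul E 1 = E := by
  funext i
  simp [frameMul, Matrix.one_apply]

omit [DecidableEq ι] in
lemma frameCoord_frameMul_inl (E : ι → HC g) (u : Matrix ι ι ℂ) (i : ι) (v : HC g) :
    frameCoord (frameMul E u) (.inl i) v =
      ∑ j, starRingEnd ℂ (u j i) * frameCoord E (.inl j) v := by
  simp only [frameCoord_inl, frameMul, map_sum, LinearMap.map_smulₛₗ, Finset.mul_sum, smul_eq_mul,
    RingHom.id_apply]
  exact Finset.sum_congr rfl fun _ _ => by ring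

omit [DecidableEq ι] in
lemma frameCoord_frameMul_inr (E : ι → HC g) (u : Matrix ι ι ℂ) (i : ι) (v : HC g) :
    frameCoord (frameMul E u) (.inr i) v = ∑ j, u j i * frameCoord E (.inr j) v := by
  simp only [frameCoord_inr, frameMul, map_sum, LinearMap.map_smul, Finset.mul_sum, smul_eq_mul]
  exact Finset.sum_congr rfl fun _ _ => by ring

lemma frameCoord_frameMul_apply {E : ι → HC g} (hE : IsFrame E) (u : Matrix ι ι ℂ) (i j : ι) :
    frameCoord E (.inl j) (frameMul E u i) = u j i := by
  have : ∀ l, frameCoord E (.inl j) (E l) = if j = l then 1 else 0 := fun l => by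
    simpa using hE.frameCoord_frameBasis (.inl j) (.inl l)
  simp [frameMul, map_sum, this]

namespace IsFrame

variable {E E' : ι → HC g}

lemma mul (hE : IsFrame E) {u : Matrix ι ι ℂ} (hu : u ∈ Matrix.unitaryGroup ι ℂ) :
    IsFrame (frameMul E u) where
  card_eq := hE.card_eq
  isotropic i j := by simp [frameMul, hE.isotropic]
  orthonormal i j := by
    have h1 := congrFun (congrFun (Matrix.mem_unitaryGroup_iff'.1 hu) j) i
    rw [Matrix.mul_apply] at h1
    simp only [Matrix.star_apply, Matrix.one_apply] at h1
    have h2 : Q g (frameMul E u i) (conj g (frameMul E u j)) =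
        -Complex.I * ∑ x, star (u x j) * u x i := by
      simp only [frameMul, map_sum, LinearMap.sum_apply, LinearMap.map_smulₛₗ, LinearMap.smul_apply,
        hE.orthonormal, smul_eq_mul, RingHom.id_apply, mul_ite, mul_zero, 
        Finset.sum_ite_eq', Finset.mem_univ, if_true, Finset.mul_sum]
      exact Finset.sum_congr rfl fun x _ => by
        rw [Complex.star_def]
        ring
    rw [h2, h1]
    by_cases hij : i = j
    · simp [hij]
    · simp [hij, Ne.symm hij]

/-- Two frames of the same Lagrangian subspace differ by a unitary matrix. -/
lemma exists_unitary (hE : IsFrame E) (hE' : IsFrame E')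
    (hmem : ∀ i, E' i ∈ frameFlag (fun _ => 0) E 0) :
    ∃ u ∈ Matrix.unitaryGroup ι ℂ, E' = frameMul E u := by
  let u : Matrix ι ι ℂ := Matrix.of fun j i => frameCoord E (.inl j) (E' i)
  have hu : E' = frameMul E u := by
    funext i
    conv_lhs => rw [← hE.sum_frameCoord (E' i)]
    rw [Fintype.sum_sum_type, frameMul]
    refine add_eq_left.2 ?_
    refine Finset.sum_eq_zero fun j _ => ?_
    rw [mem_frameFlag.1 (hmem i) (.inr j) (by simp), zero_smul]
  refine ⟨u, ?_, hu⟩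
  rw [Matrix.mem_unitaryGroup_iff']
  ext j i
  have h1 := frameCoord_frameMul_inl E u j (E' i)
  rw [← hu] at h1
  have h2 := hE'.frameCoord_frameBasis (.inl j) (.inl i)
  rw [frameBasis_inl, h1] at h2
  rw [Matrix.mul_apply, Matrix.one_apply]
  simpa [u, Matrix.of_apply] using h2

omit [DecidableEq ι] in
lemma frameFlag_le_frameMul (t : ι → ℤ) {w : Matrix ι ι ℂ}
    (hw : ∀ i j, t i ≠ t j → w i j = 0) (p : ℤ) :
    frameFlag t E p ≤ frameFlag t (frameMul E w) p := by
  intro v hv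
  rw [mem_frameFlag] at hv ⊢
  rintro (i | i) hi
  · rw [frameCoord_frameMul_inl]
    refine Finset.sum_eq_zero fun j _ => ?_
    by_cases hij : t j = t i
    · rw [hv (.inl j) (by simpa [hij] using hi), mul_zero]
    · rw [hw j i hij, map_zero, zero_mul]
  · rw [frameCoord_frameMul_inr]
    refine Finset.sum_eq_zero fun j _ => ?_
    by_cases hij : t j = t i
    · rw [hv (.inr j) (by simpa [hij] using hi), mul_zero]
    · rw [hw j i hij, zero_mul]

/-- This computes the stabilizer that appears in C'. Forwards, w i j is the i-th coordinate of the
j-th new vector, which must stay in its Hodge piece; backwards, the inverse `star w` has the same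
zero pattern as w. For constant t the condition is void, so every unitary matrix preserves the
Lagrangian. -/
lemma frameFlag_frameMul_eq_iff (hE : IsFrame E) (t : ι → ℤ) {w : Matrix ι ι ℂ}
    (hw : w ∈ Matrix.unitaryGroup ι ℂ) :
    frameFlag t (frameMul E w) = frameFlag t E ↔ ∀ i j, t i ≠ t j → w i j = 0 := by
  constructor
  · intro h i j hij
    have h1 := (hE.mul hw).frameBasis_mem_hodgePiece t (.inl j)
    rw [h, mem_hodgePiece_frameFlag] at h1
    rw [← frameCoord_frameMul_apply hE w j i]
    exact h1 (.inl i) hij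
  · intro h
    refine funext fun p => le_antisymm ?_ (frameFlag_le_frameMul t h p)
    have h1 := frameFlag_le_frameMul (E := frameMul E w) t (w := star w) (fun i j hij => by
      rw [Matrix.star_apply, h j i hij.symm, star_zero]) p
    rwa [← frameMul_mul, Matrix.mem_unitaryGroup_iff.1 hw, frameMul_one] at h1

end IsFrame

omit [Fintype ι] [DecidableEq ι] in
lemma frameCoord_spLin (γ : Sp g) (E : ι → HC g) (k : ι ⊕ ι) (v : HC g) :
    frameCoord (fun i => spLin γ (E i)) k v = frameCoord E k (spLin γ⁻¹ v) := by
  rcases k with i | i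
  · rw [frameCoord_inl, frameCoord_inl, conj_spLin]
    conv_lhs => rw [← spLin_apply_inv γ v, Q_spLin]
  · rw [frameCoord_inr, frameCoord_inr]
    conv_lhs => rw [← spLin_apply_inv γ v, Q_spLin]

omit [Fintype ι] [DecidableEq ι] in
lemma frameFlag_spLin (γ : Sp g) (t : ι → ℤ) (E : ι → HC g) (p : ℤ) :
    frameFlag t (fun i => spLin γ (E i)) p = (frameFlag t E p).map (spLin γ) := by
  ext v
  rw [mem_map_spLin, mem_frameFlag, mem_frameFlag]
  simp only [frameCoord_spLin]

lemma IsFrame.spLin (γ : Sp g) {E : ι → HC g} (hE : IsFrame E) :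
    IsFrame fun i => spLin γ (E i) where
  card_eq := hE.card_eq
  isotropic i j := by rw [Q_spLin, hE.isotropic]
  orthonormal i j := by rw [conj_spLin, Q_spLin, hE.orthonormal]

end FrameExistence

/-! ### Matching nonnegative degrees with even degrees, and the block-diagonal subgroup -/

section BlockIndex

variable {h : ℤ →₀ ℕ}

/-- The even one of the degrees `p`, `-p-1`, on the block of index `p`. -/
def blockType (h : ℤ →₀ ℕ) (i : BlockIndex h) : ℤ :=
  if Even i.1.1 then i.1.1 else -i.1.1 - 1

/-- Of p and -p-1 exactly one is nonnegative and exactly one is even, so the even representative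
determines the nonnegative one. -/
lemma blockType_eq_iff (i j : BlockIndex h) : blockType h i = blockType h j ↔ i.1 = j.1 := by
  refine ⟨fun hij => Subtype.ext ?_, fun hij => by simp [blockType, hij]⟩
  have hi := (Finset.mem_filter.1 i.1.2).2
  have hj := (Finset.mem_filter.1 j.1.2).2
  unfold blockType at hij
  split_ifs at hij <;> omega

lemma card_blockIndex : Fintype.card (BlockIndex h) = ∑ p ∈ h.support.filter (0 ≤ ·), h p := by
  rw [Fintype.card_sigma, ← Finset.sum_coe_sort (h.support.filter (0 ≤ ·))]
  simp

lemma card_fiber_blockIndex {q : ℤ} (hq : 0 ≤ q) :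
    Fintype.card {i : BlockIndex h // i.1.1 = q} = h q := by
  by_cases hs : h q = 0
  · rw [hs, Fintype.card_eq_zero_iff]
    refine ⟨fun i => ?_⟩
    have := Finsupp.mem_support_iff.1 (Finset.mem_filter.1 i.1.1.2).1
    rw [i.2] at this
    exact this hs
  · let q' : {p : ℤ // p ∈ h.support.filter (0 ≤ ·)} :=
      ⟨q, Finset.mem_filter.2 ⟨Finsupp.mem_support_iff.2 hs, hq⟩⟩
    have e : {i : BlockIndex h // i.1.1 = q} ≃ {i : BlockIndex h // i.1 = q'} :=
      Equiv.subtypeEquivRight fun i => by rw [Subtype.ext_iff]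
    rw [Fintype.card_congr (e.trans (Equiv.sigmaSubtype q'))]
    simp [q']

lemma even_blockType (i : BlockIndex h) : Even (blockType h i) := by
  unfold blockType
  split_ifs with hi
  · exact hi
  · rw [Int.even_sub_one, even_neg]
    exact hi

lemma isHodgeType_blockType (h_symm : ∀ p : ℤ, h (-p - 1) = h p) :
    IsHodgeType h (blockType h) where
  even := even_blockType
  symm := h_symm
  card p hp := by
    rcases le_or_gt 0 p with h0 | h0
    · rw [← card_fiber_blockIndex h0]
      refine Fintype.card_congr (Equiv.subtypeEquivRight fun i => ?_)
      have hi := (Finset.mem_filter.1 i.1.2).2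
      unfold blockType
      split_ifs with h1
      · rfl
      · refine iff_of_false (by omega) ?_
        rintro rfl
        exact h1 hp
    · rw [← h_symm, ← card_fiber_blockIndex (by omega)]
      refine Fintype.card_congr (Equiv.subtypeEquivRight fun i => ?_)
      have hi := (Finset.mem_filter.1 i.1.2).2
      unfold blockType
      split_ifs with h1
      · refine iff_of_false (by omega) fun hc => ?_
        rw [hc, Int.even_sub_one, even_neg] at h1
        exact h1 hp
      · omega

lemma isHodgeType_zero {g : ℕ} {ι : Type*} [Fintype ι] [DecidableEq ι]
    (hι : Fintype.card ι = g) :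
    IsHodgeType (siegelNumbers g) (fun _ : ι => 0) where
  even _ := Even.zero
  symm p := by
    have : (-p - 1 = 0 ∨ -p - 1 = -1) ↔ (p = 0 ∨ p = -1) := by omega
    simp only [siegelNumbers, this]
  card p hp := by
    by_cases h0 : p = 0
    · subst h0
      simp [siegelNumbers, hι]
    · have h1 : p ≠ -1 := by
        rintro rfl
        exact absurd hp (by decide)
      simp [siegelNumbers, h0, h1, Ne.symm h0]

lemma mem_range_blockUnitary {u : Matrix.unitaryGroup (BlockIndex h) ℂ} :
    u ∈ (blockUnitary h).range ↔ ∀ i j, i.1 ≠ j.1 → u.1 i j = 0 := by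
  constructor
  · rintro ⟨w, rfl⟩ ⟨p, i⟩ ⟨q, j⟩ hpq
    exact Matrix.blockDiagonal'_apply_ne
      (fun p => (w p : Matrix (Fin (h p.1)) (Fin (h p.1)) ℂ)) i j hpq
  · intro hu
    have h1 : Matrix.blockDiagonal' (Matrix.blockDiag' u.1) = u.1 := by
      ext ⟨p, i⟩ ⟨q, j⟩
      by_cases hpq : p = q
      · subst hpq
        rw [Matrix.blockDiagonal'_apply_eq]
        rfl
      · rw [Matrix.blockDiagonal'_apply_ne _ _ _ hpq, hu ⟨p, i⟩ ⟨q, j⟩ hpq]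
    have h2 : ∀ p, Matrix.blockDiag' u.1 p ∈ Matrix.unitaryGroup (Fin (h p.1)) ℂ := by
      intro p
      have h3 := Matrix.mem_unitaryGroup_iff.1 u.2
      rw [← h1, Matrix.star_eq_conjTranspose, Matrix.blockDiagonal'_conjTranspose,
        ← Matrix.blockDiagonal'_mul, ← Matrix.blockDiagonal'_one] at h3
      exact Matrix.mem_unitaryGroup_iff.2 (congrFun (Matrix.blockDiagonal'_injective h3) p)
    exact ⟨fun p => ⟨_, h2 p⟩, Subtype.ext h1⟩

end BlockIndex

/-! ### Finiteness and torsion in neat arithmetic groups -/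

section Arithmetic

variable {g : ℕ}

/-- The symplectic matrices with entries bounded by `C`. -/
def boundedSp (g : ℕ) (C : ℝ) : Set (Sp g) := {γ | ∀ i j, |γ.1 i j| ≤ C}

lemma finite_integralSp_inter (C : ℝ) : ((integralSp g : Set (Sp g)) ∩ boundedSp g C).Finite := by
  let S : Set (Matrix (Fin g ⊕ Fin g) (Fin g ⊕ Fin g) ℤ) :=
    {A | ∀ i j, A i j ∈ Set.Icc (-⌈C⌉) ⌈C⌉}
  have hS : S.Finite := by
    have : (Set.pi Set.univ fun _ : Fin g ⊕ Fin g => Set.pi Set.univ fun _ : Fin g ⊕ Fin g =>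
        Set.Icc (-⌈C⌉) ⌈C⌉).Finite :=
      Set.Finite.pi fun _ => Set.Finite.pi fun _ => Set.finite_Icc _ _
    exact this.subset fun A hA i _ j _ => hA i j
  refine Set.Finite.of_finite_image ((hS.image fun A => A.map (Int.castRingHom ℝ)).subset ?_)
    (Subtype.val_injective.injOn)
  rintro _ ⟨γ, ⟨⟨A, hA⟩, hC⟩, rfl⟩
  refine ⟨A, fun i j => ?_, hA.symm⟩
  have h1 := hC i j
  rw [hA, Matrix.map_apply, abs_le] at h1
  constructor
  · have : ((-⌈C⌉ : ℤ) : ℝ) ≤ (A i j : ℝ) := by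
      push_cast
      exact le_trans (neg_le_neg (Int.le_ceil C)) h1.1
    exact_mod_cast this
  · have : (A i j : ℝ) ≤ (⌈C⌉ : ℝ) := h1.2.trans (Int.le_ceil C)
    exact_mod_cast this

lemma mul_mem_boundedSp {γ δ : Sp g} {C D : ℝ} (hγ : γ ∈ boundedSp g C) (hδ : δ ∈ boundedSp g D) :
    γ * δ ∈ boundedSp g (∑ _i : Fin g ⊕ Fin g, C * D) := by
  intro i j
  have h1 : (γ * δ).1 i j = ∑ k, γ.1 i k * δ.1 k j := by
    rw [Submonoid.coe_mul, Matrix.mul_apply]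
  rw [h1]
  refine (Finset.abs_sum_le_sum_abs _ _).trans (Finset.sum_le_sum fun k _ => ?_)
  rw [abs_mul]
  exact mul_le_mul (hγ i k) (hδ k j) (abs_nonneg _) ((abs_nonneg _).trans (hγ i k))

lemma exists_mem_boundedSp (γ : Sp g) : ∃ C, γ ∈ boundedSp g C := by
  refine ⟨∑ i, ∑ j, |γ.1 i j|, fun i j => ?_⟩
  refine le_trans ?_ (Finset.single_le_sum
    (fun i _ => Finset.sum_nonneg fun j _ => abs_nonneg (γ.1 i j)) (Finset.mem_univ i))
  exact Finset.single_le_sum (fun j _ => abs_nonneg (γ.1 i j)) (Finset.mem_univ j)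

/-- Γ is a finite union of cosets r (Γ ∩ Sp(g, ℤ)). On one coset, γ = r δ with δ = r⁻¹ γ integral
and with entries bounded in terms of r and C. -/
lemma IsArithmetic.finite_inter {Γ : Subgroup (Sp g)} (hΓ : IsArithmetic Γ) (C : ℝ) :
    ((Γ : Set (Sp g)) ∩ boundedSp g C).Finite := by
  have : ((integralSp g).subgroupOf Γ).FiniteIndex := ⟨hΓ.2⟩
  let S : Γ ⧸ (integralSp g).subgroupOf Γ → Set (Sp g) := fun q =>
    (fun δ => (q.out : Sp g) * δ) '' ((integralSp g : Set (Sp g)) ∩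
      boundedSp g (∑ _i : Fin g ⊕ Fin g,
        (exists_mem_boundedSp (q.out : Sp g)⁻¹).choose * C))
  have hS : (⋃ q, S q).Finite :=
    Set.finite_iUnion fun q => (finite_integralSp_inter _).image _
  refine hS.subset ?_
  rintro γ ⟨hγ, hC⟩
  let q : Γ ⧸ (integralSp g).subgroupOf Γ := QuotientGroup.mk ⟨γ, hγ⟩
  refine Set.mem_iUnion.2 ⟨q, (q.out : Sp g)⁻¹ * γ, ⟨?_, ?_⟩, mul_inv_cancel_left _ _⟩
  · have h1 : (QuotientGroup.mk q.out : Γ ⧸ (integralSp g).subgroupOf Γ) =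
        QuotientGroup.mk ⟨γ, hγ⟩ := q.out_eq'
    have h2 := QuotientGroup.eq.1 h1
    exact h2
  · exact mul_mem_boundedSp (exists_mem_boundedSp (q.out : Sp g)⁻¹).choose_spec hC

/-- An element of finite order of a neat group is trivial. -/
lemma IsNeat.eq_one_of_pow {Γ : Subgroup (Sp g)} (hΓ : IsNeat Γ) {γ : Sp g} (hγ : γ ∈ Γ) {n : ℕ}
    (hn : 0 < n) (hγn : γ ^ n = 1) : γ = 1 := by
  set A : Matrix (Fin g ⊕ Fin g) (Fin g ⊕ Fin g) ℂ := γ.1.map Complex.ofReal with hA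
  have hAn : A ^ n = 1 := by
    have h1 := congrArg (fun δ : Sp g => δ.1.map Complex.ofRealHom) hγn
    rw [hA]
    simpa [Matrix.map_pow] using! h1
  -- The eigenvalues are roots of unity, and neatness leaves only 1.
  have hspec : ∀ z ∈ spectrum ℂ A, z = 1 := by
    intro z hz
    have hzn : z ^ n = 1 := by
      have h1 := spectrum.pow_mem_pow A n hz
      have : Nontrivial (Matrix (Fin g ⊕ Fin g) (Fin g ⊕ Fin g) ℂ) := by
        by_contra hc
        rw [not_nontrivial_iff_subsingleton] at hc
        simp [spectrum.of_subsingleton] at hz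
      rw [hAn, spectrum.one_eq] at h1
      exact h1
    have hz0 : z ≠ 0 := by
      rintro rfl
      rw [zero_pow hn.ne'] at hzn
      exact zero_ne_one hzn
    have := hΓ γ hγ (Units.mk0 z hz0) (Subgroup.subset_closure hz) n hn
      (Units.ext (by simpa using hzn))
    simpa using congrArg Units.val this
  -- Since A has the single eigenvalue 1, this sum has the single eigenvalue n ≠ 0. Being
  -- invertible, it can be cancelled from (∑ A^i)(A - 1) = A^n - 1 = 0, so no diagonalization is
  -- needed.
  have hunit : IsUnit (∑ i ∈ Finset.range n, A ^ i) := by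
    by_contra hc
    have h0 : (0 : ℂ) ∈ spectrum ℂ (Polynomial.aeval A (∑ i ∈ Finset.range n,
        (Polynomial.X : Polynomial ℂ) ^ i)) := by
      rw [spectrum.zero_mem_iff]
      simpa using hc
    have hne : (spectrum ℂ A).Nonempty := by
      have : Nontrivial (Matrix (Fin g ⊕ Fin g) (Fin g ⊕ Fin g) ℂ) := by
        by_contra hc'
        rw [not_nontrivial_iff_subsingleton] at hc'
        exact hc (isUnit_of_subsingleton _)
      exact spectrum.nonempty_of_isAlgClosed_of_finiteDimensional ℂ A
    rw [spectrum.map_polynomial_aeval_of_nonempty A _ hne] at h0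
    obtain ⟨z, hz, hz0⟩ := h0
    rw [hspec z hz] at hz0
    simp [Polynomial.eval_finsetSum] at hz0
    omega
  have h1 : (∑ i ∈ Finset.range n, A ^ i) * (A - 1) = 0 := by
    rw [geom_sum_mul, hAn, sub_self]
  have h2 : A = 1 := sub_eq_zero.1 (hunit.mul_right_eq_zero.1 h1)
  refine Subtype.ext (Matrix.map_injective Complex.ofReal_injective ?_)
  change A = (1 : Matrix _ _ ℝ).map Complex.ofReal
  rw [h2]
  ext i j
  simp [Matrix.one_apply, apply_ite Complex.ofReal]

/-- An element of a neat arithmetic group all of whose powers lie in a bounded set is trivial. -/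
lemma eq_one_of_pow_mem {Γ : Subgroup (Sp g)} (hΓ : IsArithmetic Γ) (hΓ' : IsNeat Γ) {γ : Sp g}
    (hγ : γ ∈ Γ) {C : ℝ} (hC : ∀ n : ℕ, γ ^ n ∈ boundedSp g C) : γ = 1 := by
  have hmem : ∀ n : ℕ, γ ^ n ∈ (Γ : Set (Sp g)) ∩ boundedSp g C :=
    fun n => ⟨Γ.pow_mem hγ n, hC n⟩
  obtain ⟨m, n, hmn, h⟩ := (hΓ.finite_inter C).exists_lt_map_eq_of_forall_mem hmem
  refine hΓ'.eq_one_of_pow hγ (Nat.sub_pos_of_lt hmn) ?_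
  rw [pow_sub _ hmn.le, h, mul_inv_cancel]

/-- Compactness bounds all entries on K uniformly, and the powers of an element of K stay in K. -/
lemma inf_eq_bot_of_isCompact {Γ : Subgroup (Sp g)} (hΓ : IsArithmetic Γ) (hΓ' : IsNeat Γ)
    {K : Subgroup (Sp g)} (hK : IsCompact (K : Set (Sp g))) : Γ ⊓ K = ⊥ := by
  have hb : ∃ C, ∀ γ ∈ K, γ ∈ boundedSp g C := by
    have : ∀ i j, ∃ C, ∀ γ ∈ K, |γ.1 i j| ≤ C := fun i j => by
      have hc : Continuous fun γ : Sp g => γ.1 i j :=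
        (continuous_apply_apply i j).comp continuous_subtype_val
      obtain ⟨C, hC⟩ := hK.exists_bound_of_continuousOn hc.continuousOn
      exact ⟨C, hC⟩
    choose C hC using this
    refine ⟨∑ i, ∑ j, |C i j|, fun γ hγ i j => ?_⟩
    refine (hC i j γ hγ).trans ((le_abs_self _).trans ?_)
    refine le_trans ?_ (Finset.single_le_sum
      (fun i _ => Finset.sum_nonneg fun j _ => abs_nonneg (C i j)) (Finset.mem_univ i))
    exact Finset.single_le_sum (fun j _ => abs_nonneg (C i j)) (Finset.mem_univ j)
  obtain ⟨C, hC⟩ := hb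
  rw [eq_bot_iff]
  rintro γ ⟨hγ, hγK⟩
  exact eq_one_of_pow_mem hΓ hΓ' hγ fun n => hC _ (K.pow_mem hγK n)

end Arithmetic

/-! ### Topology of the period domains; continuity of the even map and of the action -/

section Topology

variable {g : ℕ} {ι : Type*} [Fintype ι] [DecidableEq ι] {X : Type*} [TopologicalSpace X]

lemma continuous_conj : Continuous (conj g) := by
  refine (PiLp.continuous_toLp 2 _).comp (continuous_pi fun i => ?_)
  exact Complex.continuous_conj.comp ((continuous_apply i).comp (PiLp.continuous_ofLp 2 _))

lemma continuous_Q : Continuous fun x : HC g × HC g => Q g x.1 x.2 := by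
  simp only [Q_sum]
  fun_prop

lemma inner_conj (v w : HC g) : inner ℂ (conj g v) (conj g w) = starRingEnd ℂ (inner ℂ v w) := by
  simp [PiLp.inner_apply, map_sum]

lemma starProjection_conjSub (V : Submodule ℂ (HC g)) (v : HC g) :
    (conjSub V).starProjection v = conj g (V.starProjection (conj g v)) := by
  refine Submodule.eq_starProjection_of_mem_of_inner_eq_zero (K := conjSub V) ?_
    fun w hw => ?_
  · rw [mem_conjSub, conj_conj]
    exact Submodule.starProjection_apply_mem _ _
  · rw [← conj_conj v, ← map_sub, ← conj_conj w, inner_conj, conj_conj,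
      Submodule.starProjection_inner_eq_zero (K := V) _ _ hw, map_zero]

lemma continuous_starProjection_conjSub {V : X → Submodule ℂ (HC g)}
    (hV : Continuous fun x => ((V x).starProjection : HC g →L[ℂ] HC g)) :
    Continuous fun x => ((conjSub (V x)).starProjection : HC g →L[ℂ] HC g) := by
  rw [continuous_clm_apply]
  intro v
  simp only [starProjection_conjSub]
  exact continuous_conj.comp (hV.clm_apply continuous_const)

/-- The partial sums of the expansion in the basis `(E, conj E)`. -/
noncomputable def frameSum (A : Finset (ι ⊕ ι)) (E : ι → HC g) : HC g →L[ℂ] HC g :=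
  LinearMap.toContinuousLinearMap (∑ k ∈ A, (frameCoord E k).smulRight (frameBasis E k))

omit [Fintype ι] [DecidableEq ι] in
lemma frameSum_apply (A : Finset (ι ⊕ ι)) (E : ι → HC g) (v : HC g) :
    frameSum A E v = ∑ k ∈ A, frameCoord E k v • frameBasis E k := by
  simp [frameSum]

omit [Fintype ι] [DecidableEq ι] in
lemma continuous_frameBasis (k : ι ⊕ ι) : Continuous fun E : ι → HC g => frameBasis E k := by
  rcases k with i | i
  · exact continuous_apply i
  · exact continuous_conj.comp (continuous_apply i)

omit [Fintype ι] [DecidableEq ι] in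
lemma continuous_frameCoord (k : ι ⊕ ι) :
    Continuous fun x : (ι → HC g) × HC g => frameCoord x.1 k x.2 := by
  rcases k with i | i
  · exact continuous_const.mul (continuous_Q.comp (continuous_snd.prodMk
      (continuous_conj.comp ((continuous_apply i).comp continuous_fst))))
  · exact continuous_const.mul (continuous_Q.comp (continuous_snd.prodMk
      ((continuous_apply i).comp continuous_fst)))

omit [Fintype ι] [DecidableEq ι] in
lemma continuous_frameSum (A : Finset (ι ⊕ ι)) :
    Continuous (frameSum A : (ι → HC g) → HC g →L[ℂ] HC g) := by
  rw [continuous_clm_apply]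
  intro v
  simp only [frameSum_apply]
  exact continuous_finsetSum _ fun k _ =>
    ((continuous_frameCoord k).comp (continuous_id.prodMk continuous_const)).smul
      (continuous_frameBasis k)

namespace IsFrame

variable {E : ι → HC g}

lemma frameCoord_frameSum (hE : IsFrame E) (A : Finset (ι ⊕ ι)) (k : ι ⊕ ι) (v : HC g) :
    frameCoord E k (frameSum A E v) = if k ∈ A then frameCoord E k v else 0 := by
  rw [frameSum_apply, map_sum]
  simp [hE.frameCoord_frameBasis]

lemma frameSum_eq_self (hE : IsFrame E) {A : Finset (ι ⊕ ι)} {v : HC g}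
    (hv : ∀ k ∉ A, frameCoord E k v = 0) : frameSum A E v = v := by
  conv_rhs => rw [← hE.sum_frameCoord v]
  rw [frameSum_apply]
  exact Finset.sum_subset (Finset.subset_univ A) fun k _ hk => by rw [hv k hk, zero_smul]

end IsFrame

/-- The basis vectors of type at least `p`. -/
def typeGE (t : ι → ℤ) (p : ℤ) : Finset (ι ⊕ ι) := Finset.univ.filter (p ≤ frameType t ·)

omit [DecidableEq ι] in
lemma mem_typeGE {t : ι → ℤ} {p : ℤ} {k : ι ⊕ ι} : k ∈ typeGE t p ↔ p ≤ frameType t k := by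
  simp [typeGE]

/-- The partial sum over types ≥ p is an idempotent with image F^p that depends visibly continuously
on E; the orthogonal projection then does too. -/
lemma continuous_starProjection_frameFlag (t : ι → ℤ) (p : ℤ) :
    Continuous fun E : {E : ι → HC g // IsFrame E} =>
      ((frameFlag t E.1 p).starProjection : HC g →L[ℂ] HC g) := by
  refine continuous_starProjection
    ((continuous_frameSum (typeGE t p)).comp continuous_subtype_val) (fun E v => ?_)
    fun E v hv => ?_
  · rw [mem_frameFlag]
    intro k hk
    rw [Function.comp_apply, E.2.frameCoord_frameSum, if_neg]
    rw [mem_typeGE]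
    omega
  · refine E.2.frameSum_eq_self fun k hk => mem_frameFlag.1 hv k ?_
    rw [mem_typeGE] at hk
    omega

lemma continuous_domain_iff {h : ℤ → ℕ} {f : X → Domain g h} :
    Continuous f ↔ ∀ p, Continuous fun x => (((f x).1 p).starProjection : HC g →L[ℂ] HC g) := by
  rw [continuous_induced_rng, continuous_pi_iff]
  rfl

lemma continuous_domain_starProjection {h : ℤ → ℕ} (p : ℤ) :
    Continuous fun F : Domain g h => ((F.1 p).starProjection : HC g →L[ℂ] HC g) :=
  continuous_domain_iff.1 continuous_id p

instance (h : ℤ → ℕ) : T2Space (Domain g h) := by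
  refine T2Space.of_injective_continuous
    (f := fun F : Domain g h => fun p : ℤ => ((F.1 p).starProjection : HC g →L[ℂ] HC g)) ?_
    continuous_induced_dom
  intro F F' hF
  exact Subtype.ext (funext fun p => starProjection_injective (congrFun hF p))

/-- The Hodge structure given by a frame. -/
noncomputable def frameDomain {h : ℤ → ℕ} {t : ι → ℤ} (ht : IsHodgeType h t)
    (E : {E : ι → HC g // IsFrame E}) : Domain g h :=
  ⟨frameFlag t E.1, E.2.isPolarizedHodge ht⟩

lemma continuous_frameDomain {h : ℤ → ℕ} {t : ι → ℤ} (ht : IsHodgeType h t) :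
    Continuous (frameDomain (g := g) ht) :=
  continuous_domain_iff.2 fun p => continuous_starProjection_frameFlag t p

lemma frameDomain_surjective {h : ℤ → ℕ} {t : ι → ℤ} (ht : IsHodgeType h t)
    (hι : Fintype.card ι = g) : Function.Surjective (frameDomain (g := g) ht) := by
  intro F
  obtain ⟨E, hE, hF⟩ := exists_isFrame ht hι F.2
  exact ⟨⟨E, hE⟩, Subtype.ext hF.symm⟩

lemma evenMap_frameDomain {h : ℤ → ℕ} {t : ι → ℤ} (ht : IsHodgeType h t)
    (ht' : IsHodgeType (siegelNumbers g) fun _ : ι => 0) (E : {E : ι → HC g // IsFrame E}) :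
    evenMap g h (frameDomain ht E) = frameDomain ht' E :=
  Subtype.ext (E.2.evenFiltration_frameFlag ht.even)

/-- The frames s x need not vary continuously. The partial sum is the projection onto F^p along conj
F^{-p}, so it depends only on the Hodge structure, which does. -/
lemma continuous_frameSum_typeGE {h : ℤ → ℕ} {t : ι → ℤ} (ht : IsHodgeType h t)
    {s : X → {E : ι → HC g // IsFrame E}} (hs : Continuous fun x => frameDomain ht (s x)) (p : ℤ) :
    Continuous fun x => frameSum (typeGE t p) (s x).1 := by
  have h1 := continuous_domain_iff.1 hs
  refine continuous_oblique (fun x => (frameDomain ht (s x)).2.isCompl p) (h1 p)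
    (continuous_starProjection_conjSub (h1 (-p))) (fun x v hv => ?_) fun x v hv => ?_
  · refine (s x).2.frameSum_eq_self fun k hk => mem_frameFlag.1 hv k ?_
    rw [mem_typeGE] at hk
    omega
  · refine (s x).2.frameCoord_eq_zero fun k => ?_
    rw [(s x).2.frameCoord_frameSum]
    split_ifs with hk
    · refine mem_conjSub_frameFlag.1 hv k ?_
      rw [mem_typeGE] at hk
      omega
    · rfl

lemma continuous_evenMap_of_isHodgeType {h : ℤ → ℕ} {t : ι → ℤ} (ht : IsHodgeType h t)
    (hι : Fintype.card ι = g) : Continuous (evenMap g h) := by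
  choose s hs using frameDomain_surjective (g := g) ht hι
  have hsc : Continuous fun F => frameDomain ht (s F) := by
    simp only [hs]
    exact continuous_id
  have ht' := isHodgeType_zero hι
  have hR : Continuous fun F =>
      frameSum (Finset.univ.map ⟨Sum.inl, Sum.inl_injective⟩) (s F).1 := by
    -- The projection onto the even part is the sum over even types q of the projections onto the
    -- pieces H^{q,-q-1}, each a difference of two consecutive partial sums. Each depends
    -- continuously on F although the frame s F is an arbitrary choice.
    have key : ∀ F, frameSum (Finset.univ.map ⟨Sum.inl, Sum.inl_injective⟩) (s F).1 =
        ∑ q ∈ Finset.univ.image t, (frameSum (typeGE t q) (s F).1 -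
          frameSum (typeGE t (q + 1)) (s F).1) := by
      intro F
      ext1 v
      rw [_root_.sum_apply, ← sub_eq_zero]
      refine (s F).2.frameCoord_eq_zero fun k => ?_
      rw [map_sub, map_sum, (s F).2.frameCoord_frameSum]
      have h1 : ∀ q, frameCoord (s F).1 k ((frameSum (typeGE t q) (s F).1 -
          frameSum (typeGE t (q + 1)) (s F).1) v) =
          if frameType t k = q then frameCoord (s F).1 k v else 0 := by
        intro q
        rw [_root_.sub_apply, map_sub, (s F).2.frameCoord_frameSum, (s F).2.frameCoord_frameSum]
        simp only [mem_typeGE]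
        split_ifs <;> first | omega | simp
      simp only [h1, Finset.sum_ite_eq]
      rcases k with i | i
      · simp
      · rw [if_neg (by simp), if_neg, sub_self]
        simp only [Finset.mem_image, Finset.mem_univ, true_and, frameType_inr, not_exists]
        intro j hj
        obtain ⟨a, ha⟩ := ht.even i
        obtain ⟨b, hb⟩ := ht.even j
        omega
    simp only [key]
    exact continuous_finsetSum _ fun q _ =>
      (continuous_frameSum_typeGE ht hsc q).sub (continuous_frameSum_typeGE ht hsc (q + 1))
  rw [continuous_domain_iff]
  intro p
  rcases lt_trichotomy p 0 with hp | rfl | hp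
  · have : ∀ F : Domain g h, (evenMap g h F).1 p = ⊤ := fun F => evenFiltration_neg _ hp
    exact continuous_starProjection (R := fun _ : Domain g h => 1) continuous_const
      (fun F v => by rw [this]; trivial) fun F v _ => rfl
  · have h0 : ∀ F : Domain g h, ∀ v, v ∈ (evenMap g h F).1 0 ↔
        ∀ i, frameCoord (s F).1 (.inr i) v = 0 := by
      intro F v
      have h2 := (s F).2.mem_evenPart ht.even (v := v)
      rw [← h2]
      conv_lhs => rw [← hs F]
      exact Iff.of_eq (congrArg (v ∈ ·) (evenFiltration_zero _))
    refine continuous_starProjection hR (fun F v => ?_) fun F v hv => ?_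
    · rw [h0]
      intro i
      rw [(s F).2.frameCoord_frameSum, if_neg (by simp)]
    · refine (s F).2.frameSum_eq_self ?_
      rintro (i | i) hi
      · simp at hi
      · exact (h0 F v).1 hv i
  · have : ∀ F : Domain g h, (evenMap g h F).1 p = ⊥ := fun F => evenFiltration_pos _ hp
    refine continuous_starProjection (R := fun _ : Domain g h => 0) continuous_const
      (fun F v => zero_mem _) fun F v hv => ?_
    rw [this, Submodule.mem_bot] at hv
    rw [hv, map_zero]

/-- If P projects orthogonally onto F^p, then γ P γ⁻¹ is an idempotent with image γ F^p, generally
not orthogonal. -/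
instance (h : ℤ → ℕ) : ContinuousConstSMul (Sp g) (Domain g h) where
  continuous_const_smul γ := by
    rw [continuous_domain_iff]
    intro p
    let T : HC g →L[ℂ] HC g := LinearMap.toContinuousLinearMap (spLin γ)
    let T' : HC g →L[ℂ] HC g := LinearMap.toContinuousLinearMap (spLin γ⁻¹)
    refine continuous_starProjection (R := fun F : Domain g h => T * (F.1 p).starProjection * T')
      ((continuous_const.mul (continuous_domain_starProjection p)).mul continuous_const)
      (fun F v => ?_) fun F v hv => ?_
    · exact ⟨_, Submodule.starProjection_apply_mem (F.1 p) (spLin γ⁻¹ v), rfl⟩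
    · obtain ⟨w, hw, rfl⟩ := hv
      change spLin γ ((F.1 p).starProjection (spLin γ⁻¹ (spLin γ w))) = spLin γ w
      rw [spLin_inv_apply, Submodule.starProjection_eq_self_iff.2 hw]

lemma smul_frameDomain {h : ℤ → ℕ} {t : ι → ℤ} (ht : IsHodgeType h t) (γ : Sp g)
    (E : {E : ι → HC g // IsFrame E}) :
    γ • frameDomain ht E = frameDomain ht ⟨fun i => spLin γ (E.1 i), E.2.spLin γ⟩ :=
  Subtype.ext (funext fun p => (frameFlag_spLin γ t E.1 p).symm)

end Topology

/-! ### Continuous local frames on the Siegel space -/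

section LocalFrame

variable {g : ℕ} {ι : Type*} [Fintype ι] [DecidableEq ι]

/-- The Gram matrix for the Hermitian form `i Q(v, conj w)`. -/
noncomputable def gram (f : ι → HC g) : Matrix ι ι ℂ :=
  Matrix.of fun l j => Complex.I * Q g (f j) (conj g (f l))

omit [Fintype ι] [DecidableEq ι] in
lemma continuous_gram : Continuous (gram : (ι → HC g) → Matrix ι ι ℂ) := by
  refine continuous_matrix fun l j => continuous_const.mul ?_
  have h1 : Continuous fun f : ι → HC g => (f j, conj g (f l)) :=
    (continuous_apply j).prodMk (continuous_conj.comp (continuous_apply l))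
  exact continuous_Q.comp h1

omit [DecidableEq ι] in
lemma gram_frameMul (f : ι → HC g) (u : Matrix ι ι ℂ) :
    gram (frameMul f u) = star u * gram f * u := by
  ext k i
  simp only [gram, frameMul, Matrix.of_apply, map_sum, LinearMap.sum_apply, LinearMap.map_smulₛₗ,
    LinearMap.smul_apply, smul_eq_mul, RingHom.id_apply, Matrix.mul_apply, Matrix.star_apply,
    Finset.mul_sum, Finset.sum_mul, Complex.star_def]
  refine Finset.sum_comm.trans (Finset.sum_congr rfl fun x _ => Finset.sum_congr rfl fun y _ => ?_)
  ring

lemma IsFrame.gram_eq_one {E : ι → HC g} (hE : IsFrame E) : gram E = 1 := by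
  ext l j
  rw [gram, Matrix.of_apply, hE.orthonormal, Matrix.one_apply]
  by_cases hij : l = j
  · simp [hij]
  · simp [hij, Ne.symm hij]

-- On the Lagrangian of E the form i Q(v, conj v) is the sum of the |coordinates|² along E.
open scoped ComplexOrder in
lemma IsFrame.posSemidef_gram {E : ι → HC g} (hE : IsFrame E) {f : ι → HC g}
    (hf : ∀ i, f i ∈ frameFlag (fun _ => 0) E 0) : (gram f).PosSemidef := by
  refine .of_dotProduct_mulVec_nonneg ?_ fun x => ?_
  · ext l j
    rw [Matrix.conjTranspose_apply, gram, Matrix.of_apply, Matrix.of_apply, Complex.star_def,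
      star_hermitian]
  · let v := ∑ j, x j • f j
    have h1 : star x ⬝ᵥ gram f *ᵥ x = Complex.I * Q g v (conj g v) := by
      simp only [v, dotProduct, Matrix.mulVec, gram, Matrix.of_apply, map_sum, LinearMap.sum_apply,
        LinearMap.map_smulₛₗ, LinearMap.smul_apply, smul_eq_mul, RingHom.id_apply, Finset.mul_sum,
        Pi.star_apply, Complex.star_def]
      refine Finset.sum_congr rfl fun k _ => Finset.sum_congr rfl fun i _ => ?_
      ring
    have hv : v ∈ frameFlag (fun _ => 0) E 0 :=
      Submodule.sum_mem _ fun j _ => Submodule.smul_mem _ _ (hf j)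
    have h2 : ∀ i, frameCoord E (.inr i) v = 0 := fun i => mem_frameFlag.1 hv _ (by simp)
    rw [h1, hE.Q_conj_eq, ← mul_assoc, mul_neg, Complex.I_mul_I, neg_neg, one_mul,
      Complex.zero_le_real]
    refine Finset.sum_nonneg fun i _ => ?_
    rw [h2, norm_zero, zero_pow two_ne_zero, sub_zero]
    positivity

-- Take B = G^{-1/2}: the square root is continuous on nonnegative matrices and B is self-adjoint,
-- so B G B = 1.
open scoped ComplexOrder MatrixOrder Matrix.Norms.L2Operator in
lemma exists_continuous_unitarizer {X : Type*} [TopologicalSpace X] {G : X → Matrix ι ι ℂ}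
    (hG : Continuous G) (hpos : ∀ x, (G x).PosSemidef) (hu : ∀ x, IsUnit (G x)) :
    ∃ B : X → Matrix ι ι ℂ, Continuous B ∧ ∀ x, star (B x) * G x * B x = 1 := by
  have hpos' : ∀ x, 0 ≤ G x := fun x => Matrix.nonneg_iff_posSemidef.2 (hpos x)
  have hS : ∀ x, IsUnit (CFC.sqrt (G x)) := fun x => (CFC.isUnit_sqrt_iff (G x) (hpos' x)).2 (hu x)
  refine ⟨fun x => Ring.inverse (CFC.sqrt (G x)), ?_, fun x => ?_⟩
  · exact continuous_ringInverse (CFC.continuousOn_sqrt.comp_continuous hG hpos') hS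
  · have h1 : star (CFC.sqrt (G x)) = CFC.sqrt (G x) :=
      (IsSelfAdjoint.of_nonneg (CFC.sqrt_nonneg (G x))).star_eq
    have h2 : star (Ring.inverse (CFC.sqrt (G x))) = Ring.inverse (CFC.sqrt (G x)) := by
      rw [← Ring.inverse_star, h1]
    have h3 := CFC.sqrt_mul_sqrt_self (G x) (hpos' x)
    calc star (Ring.inverse (CFC.sqrt (G x))) * G x * Ring.inverse (CFC.sqrt (G x))
        = (Ring.inverse (CFC.sqrt (G x)) * CFC.sqrt (G x)) *
          (CFC.sqrt (G x) * Ring.inverse (CFC.sqrt (G x))) := by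
          rw [h2]
          nth_rewrite 2 [← h3]
          simp only [mul_assoc]
      _ = 1 := by
          rw [Ring.inverse_mul_cancel _ (hS x), Ring.mul_inverse_cancel _ (hS x), mul_one]

/-- Locally on the Siegel space there are continuous frames. -/
lemma exists_local_frame (ht : IsHodgeType (siegelNumbers g) fun _ : ι => 0)
    (hι : Fintype.card ι = g) (W₀ : Siegel g) :
    ∃ U : Set (Siegel g), IsOpen U ∧ W₀ ∈ U ∧ ∃ s : U → {E : ι → HC g // IsFrame E},
      Continuous s ∧ ∀ W : U, frameDomain ht (s W) = W := by
  choose E hE using frameDomain_surjective (g := g) ht hι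
  -- The frame of the base point is projected orthogonally onto the nearby Lagrangian W. This is
  -- continuous in W, whereas the frames E W are pointwise choices used only to verify algebraic
  -- identities.
  let f : Siegel g → ι → HC g := fun W i => (W.1 0).starProjection ((E W₀).1 i)
  have hf : Continuous f := continuous_pi fun i =>
    (continuous_domain_starProjection 0).clm_apply continuous_const
  have hfmem : ∀ W i, f W i ∈ frameFlag (fun _ => 0) (E W).1 0 := fun W i => by
    have h1 : f W i ∈ W.1 0 := Submodule.starProjection_apply_mem _ _
    rwa [← congrArg (fun W : Siegel g => W.1 0) (hE W)] at h1
  have hf₀ : f W₀ = (E W₀).1 := by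
    funext i
    refine Submodule.starProjection_eq_self_iff.2 ?_
    have h1 := ((E W₀).2.frameBasis_mem_hodgePiece (fun _ => 0) (.inl i)).1
    rwa [← congrArg (fun W : Siegel g => W.1 0) (hE W₀)]
  have hgf : Continuous fun W => gram (f W) := continuous_gram.comp hf
  -- Where the Gram matrix is invertible, the projected vectors are still a basis of W and can be
  -- orthonormalized.
  let U : Set (Siegel g) := {W | IsUnit (gram (f W))}
  have hU : IsOpen U := by
    have : U = (fun W => (gram (f W)).det) ⁻¹' {0}ᶜ := by
      ext W
      simp [U, Matrix.isUnit_iff_isUnit_det]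
    rw [this]
    exact isOpen_compl_singleton.preimage hgf.matrix_det
  obtain ⟨B, hB, hB1⟩ := exists_continuous_unitarizer (X := U) (G := fun W => gram (f W))
    (hgf.comp continuous_subtype_val) (fun W => (E W).2.posSemidef_gram (hfmem W)) fun W => W.2
  have hmem : ∀ (W : U) i, frameMul (f W) (B W) i ∈ frameFlag (fun _ => 0) (E W).1 0 :=
    fun W i => Submodule.sum_mem _ fun j _ => Submodule.smul_mem _ _ (hfmem W j)
  have hframe : ∀ W : U, IsFrame (frameMul (f W) (B W)) := fun W => by
    refine ⟨hι, fun i j => ?_, fun i j => ?_⟩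
    · exact ((E W).2.isPolarizedHodge ht).isotropic 0 _ (hmem W i) _ (by simpa using hmem W j)
    · have h1 : gram (frameMul (f W) (B W)) j i = (1 : Matrix ι ι ℂ) j i := by
        rw [gram_frameMul, hB1]
      rw [gram, Matrix.of_apply, Matrix.one_apply] at h1
      calc _ = -Complex.I * (Complex.I *
            Q g (frameMul (f W) (B W) i) (conj g (frameMul (f W) (B W) j))) := by
            rw [← mul_assoc]; simp
        _ = _ := by
            rw [h1]
            by_cases hij : i = j
            · simp [hij]
            · simp [hij, Ne.symm hij]
  refine ⟨U, hU, ?_, fun W => ⟨_, hframe W⟩, ?_, fun W => ?_⟩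
  · change IsUnit (gram (f W₀))
    rw [hf₀, (E W₀).2.gram_eq_one]
    exact isUnit_one
  · refine Continuous.subtype_mk (continuous_pi fun i => continuous_finsetSum _ fun j _ => ?_) _
    exact (hB.matrix_elem j i).smul
      ((continuous_apply j).comp (hf.comp continuous_subtype_val))
  · obtain ⟨u, hu, hEu⟩ := (E W).2.exists_unitary (hframe W) (hmem W)
    rw [← hE W]
    refine Subtype.ext ?_
    change frameFlag _ (frameMul (f W) (B W)) = frameFlag _ (E W).1
    rw [hEu, (E W).2.frameFlag_frameMul_eq_iff _ hu]
    exact fun i j hij => absurd rfl hij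

end LocalFrame

/-! ### Compactness and separation of the fiber -/

section Fiber

instance {ι : Type*} [Fintype ι] [DecidableEq ι] : CompactSpace (Matrix.unitaryGroup ι ℂ) := by
  suffices IsCompact (Matrix.unitaryGroup ι ℂ : Set (Matrix ι ι ℂ)) from
    isCompact_iff_compactSpace.1 this
  have h1 : IsClosed (Matrix.unitaryGroup ι ℂ : Set (Matrix ι ι ℂ)) := by
    have : (Matrix.unitaryGroup ι ℂ : Set (Matrix ι ι ℂ)) = {u | u * star u = 1} := by
      ext u
      exact Matrix.mem_unitaryGroup_iff
    rw [this]
    exact isClosed_eq (continuous_id.matrix_mul continuous_id.matrix_conjTranspose)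
      continuous_const
  have h2 : IsCompact (Set.pi Set.univ fun _ : ι => Set.pi Set.univ fun _ : ι =>
      Metric.closedBall (0 : ℂ) 1) :=
    isCompact_univ_pi fun _ => isCompact_univ_pi fun _ => isCompact_closedBall _ _
  refine h2.of_isClosed_subset h1 fun u hu i _ j _ => ?_
  rw [mem_closedBall_zero_iff]
  exact entry_norm_bound_of_unitary hu i j

variable {h : ℤ →₀ ℕ}

/-- An invertible diagonal matrix whose centralizer consists of the block-diagonal matrices. -/
noncomputable def blockScalar (h : ℤ →₀ ℕ) : Matrix (BlockIndex h) (BlockIndex h) ℂ :=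
  Matrix.diagonal fun i => ((i.1.1 + 1 : ℤ) : ℂ)

/-- The shift by one in `blockScalar` matters: p ≥ 0 makes p + 1 nonzero, and conjugation by this
matrix is used for logarithms. -/
lemma isUnit_blockScalar : IsUnit (blockScalar h) := by
  rw [blockScalar, Matrix.isUnit_diagonal, Pi.isUnit_iff]
  intro i
  have hi := (Finset.mem_filter.1 i.1.2).2
  rw [isUnit_iff_ne_zero, Int.cast_ne_zero]
  omega

lemma commute_blockScalar_iff (u : Matrix (BlockIndex h) (BlockIndex h) ℂ) :
    blockScalar h * u = u * blockScalar h ↔ ∀ i j, i.1 ≠ j.1 → u i j = 0 := by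
  rw [← Matrix.ext_iff]
  refine forall_congr' fun i => forall_congr' fun j => ?_
  rw [blockScalar, Matrix.diagonal_mul, Matrix.mul_diagonal, mul_comm, ← sub_eq_zero, ← mul_sub,
    mul_eq_zero, sub_eq_zero, Int.cast_inj, add_left_inj,
    ← Subtype.ext_iff]
  tauto

lemma mem_range_blockUnitary_iff_commute {u : Matrix.unitaryGroup (BlockIndex h) ℂ} :
    u ∈ (blockUnitary h).range ↔ blockScalar h * u.1 = u.1 * blockScalar h := by
  rw [mem_range_blockUnitary, commute_blockScalar_iff]

/-- With P the matrix `blockScalar h`, the map u ↦ u P u* is constant exactly on the cosets of the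
centralizer of P, so it injects the quotient continuously into matrices. -/
instance : T2Space (FlagFiber h) := by
  let f : Matrix.unitaryGroup (BlockIndex h) ℂ → Matrix (BlockIndex h) (BlockIndex h) ℂ :=
    fun u => u.1 * blockScalar h * star u.1
  have hf : Continuous f := (continuous_subtype_val.matrix_mul continuous_const).matrix_mul
    continuous_subtype_val.matrix_conjTranspose
  have key : ∀ u w, (u⁻¹ * w ∈ (blockUnitary h).range) ↔ f u = f w := by
    intro u w
    rw [mem_range_blockUnitary_iff_commute]
    have hu := Matrix.mem_unitaryGroup_iff.1 u.2
    have hu' := Matrix.mem_unitaryGroup_iff'.1 u.2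
    have hw := Matrix.mem_unitaryGroup_iff.1 w.2
    have hw' := Matrix.mem_unitaryGroup_iff'.1 w.2
    change blockScalar h * (star u.1 * w.1) = star u.1 * w.1 * blockScalar h ↔
      u.1 * blockScalar h * star u.1 = w.1 * blockScalar h * star w.1
    constructor
    · intro h1
      calc u.1 * blockScalar h * star u.1
          = u.1 * (blockScalar h * (star u.1 * w.1)) * star w.1 := by
            simp only [mul_assoc, hw, mul_one]
        _ = w.1 * blockScalar h * star w.1 := by
            rw [h1]
            simp only [← mul_assoc, hu, one_mul]
    · intro h1
      calc blockScalar h * (star u.1 * w.1)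
          = star u.1 * (u.1 * blockScalar h * star u.1) * w.1 := by
            simp only [← mul_assoc, hu', one_mul]
        _ = star u.1 * w.1 * blockScalar h := by
            rw [h1]
            simp only [mul_assoc, hw', mul_one]
  refine T2Space.of_injective_continuous
    (f := Quotient.lift f fun u w huw => (key u w).1 (QuotientGroup.leftRel_apply.1 huw)) ?_
    (hf.quotient_lift _)
  rintro ⟨u⟩ ⟨w⟩ huw
  exact QuotientGroup.eq.2 ((key u w).2 huw)

end Fiber

/-! ### Local triviality of the even map before passing to quotients -/

section LocalTriviality

variable {g : ℕ} {h : ℤ →₀ ℕ}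

/-- The family of Hodge structures over a family of frames, parametrized by the fiber. -/
noncomputable def flagFamily {U : Type*} (ht : IsHodgeType h (blockType h))
    (s : U → {E : BlockIndex h → HC g // IsFrame E}) (x : U × FlagFiber h) : Domain g h :=
  Quotient.liftOn' x.2
    (fun u => frameDomain ht ⟨frameMul (s x.1).1 u.1, (s x.1).2.mul u.2⟩) fun u w huw => by
      have h1 : u⁻¹ * w ∈ (blockUnitary h).range := QuotientGroup.leftRel_apply.1 huw
      refine Subtype.ext ?_
      change frameFlag _ (frameMul _ u.1) = frameFlag _ (frameMul _ w.1)
      have h2 : w.1 = u.1 * (u⁻¹ * w).1 := by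
        rw [← Submonoid.coe_mul, mul_inv_cancel_left]
      rw [h2, frameMul_mul, eq_comm,
        ((s x.1).2.mul u.2).frameFlag_frameMul_eq_iff _ (u⁻¹ * w).2]
      exact fun i j hij => mem_range_blockUnitary.1 h1 i j
        fun hc => hij ((blockType_eq_iff i j).2 hc)

lemma flagFamily_mk {U : Type*} (ht : IsHodgeType h (blockType h))
    (s : U → {E : BlockIndex h → HC g // IsFrame E}) (W : U)
    (u : Matrix.unitaryGroup (BlockIndex h) ℂ) :
    flagFamily ht s (W, (u : FlagFiber h)) =
      frameDomain ht ⟨frameMul (s W).1 u.1, (s W).2.mul u.2⟩ := rfl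

lemma continuous_flagFamily {U : Type*} [TopologicalSpace U] (ht : IsHodgeType h (blockType h))
    {s : U → {E : BlockIndex h → HC g // IsFrame E}} (hs : Continuous s) :
    Continuous (flagFamily ht s) := by
  -- The quotient map onto C' is open, so its product with the identity of U is again a quotient map
  -- and continuity can be tested on U × U(g).
  rw [← (IsOpenQuotientMap.id.prodMap QuotientGroup.isOpenQuotientMap_mk).continuous_comp_iff]
  change Continuous fun x : U × Matrix.unitaryGroup (BlockIndex h) ℂ =>
    frameDomain ht ⟨frameMul (s x.1).1 x.2.1, (s x.1).2.mul x.2.2⟩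
  refine (continuous_frameDomain ht).comp (Continuous.subtype_mk (continuous_pi fun i =>
    continuous_finsetSum _ fun j _ => ?_) _)
  exact ((continuous_subtype_val.comp continuous_snd).matrix_elem j i).smul
    ((continuous_apply j).comp (continuous_subtype_val.comp (hs.comp continuous_fst)))

/-- Over an open set with a continuous family of frames, the even map is a product. -/
lemma isOpenEmbedding_flagFamily (ht : IsHodgeType h (blockType h))
    (ht' : IsHodgeType (siegelNumbers g) fun _ : BlockIndex h => 0)
    (hg : Fintype.card (BlockIndex h) = g) {U : Set (Siegel g)} (hU : IsOpen U)
    {s : U → {E : BlockIndex h → HC g // IsFrame E}} (hs : Continuous s)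
    (hsU : ∀ W : U, frameDomain ht' (s W) = W) :
    Topology.IsOpenEmbedding (flagFamily ht s) ∧
      Set.range (flagFamily ht s) = evenMap g h ⁻¹' U ∧
      ∀ x, evenMap g h (flagFamily ht s x) = x.1 := by
  have heven : ∀ x, evenMap g h (flagFamily ht s x) = x.1 := by
    rintro ⟨W, ⟨u⟩⟩
    change evenMap g h (frameDomain ht ⟨frameMul (s W).1 u.1, (s W).2.mul u.2⟩) = W
    rw [evenMap_frameDomain ht ht', ← hsU W]
    refine Subtype.ext (((s W).2.frameFlag_frameMul_eq_iff _ u.2).2 fun i j hij => absurd rfl hij)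
  have hrange : Set.range (flagFamily ht s) = evenMap g h ⁻¹' U := by
    refine Set.Subset.antisymm ?_ fun F hF => ?_
    · rintro _ ⟨x, rfl⟩
      rw [Set.mem_preimage, heven]
      exact x.1.2
    · obtain ⟨E, rfl⟩ := frameDomain_surjective ht hg F
      let W : U := ⟨_, hF⟩
      obtain ⟨u, hu, hEu⟩ := (s W).2.exists_unitary E.2 fun i => by
        have h1 : frameDomain ht' (s W) = frameDomain ht' E := by
          rw [hsU, ← evenMap_frameDomain ht ht']
        have h2 : frameFlag (fun _ => 0) (s W).1 0 = frameFlag (fun _ => 0) E.1 0 :=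
          congrArg (fun W : Siegel g => W.1 0) h1
        rw [h2]
        exact (E.2.frameBasis_mem_hodgePiece (fun _ => 0) (.inl i)).1
      refine ⟨(W, ((⟨u, hu⟩ : Matrix.unitaryGroup (BlockIndex h) ℂ) : FlagFiber h)), ?_⟩
      rw [flagFamily_mk]
      congr 1
      exact Subtype.ext hEu.symm
  have hinj : Function.Injective (flagFamily ht s) := by
    rintro ⟨W, ⟨u⟩⟩ ⟨W', ⟨w⟩⟩ hx
    have hW : W = W' := Subtype.ext (by simpa only [heven] using congrArg (evenMap g h) hx)
    subst hW
    refine Prod.ext rfl (QuotientGroup.eq.2 (mem_range_blockUnitary.2 fun i j hij => ?_))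
    have h1 : frameFlag (blockType h) (frameMul (s W).1 u.1) =
      frameFlag (blockType h) (frameMul (s W).1 w.1) := congrArg Subtype.val hx
    have h2 : w.1 = u.1 * (u⁻¹ * w).1 := by
      rw [← Submonoid.coe_mul, mul_inv_cancel_left]
    rw [h2, frameMul_mul, eq_comm,
      ((s W).2.mul u.2).frameFlag_frameMul_eq_iff _ (u⁻¹ * w).2] at h1
    exact h1 i j fun hc => hij ((blockType_eq_iff i j).1 hc)
  have hc := continuous_flagFamily ht hs
  have hce : Continuous (evenMap g h) := continuous_evenMap_of_isHodgeType ht hg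
  let f : U × FlagFiber h → evenMap g h ⁻¹' U := fun x => ⟨flagFamily ht s x, by
    rw [Set.mem_preimage, heven]; exact x.1.2⟩
  have hf : Continuous f := hc.subtype_mk _
  -- Composed with the even map, f becomes the projection U × C' → U, proper because C' is compact.
  -- Hence f is proper, and a proper continuous bijection is a homeomorphism.
  have hproper : IsProperMap f := by
    refine isProperMap_of_comp_of_t2 hf
      (g := fun F : evenMap g h ⁻¹' U => (⟨evenMap g h F.1, F.2⟩ : U))
      ((hce.comp continuous_subtype_val).subtype_mk _) ?_
    have : (fun F : evenMap g h ⁻¹' U => (⟨evenMap g h F.1, F.2⟩ : U)) ∘ f = Prod.fst :=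
      funext fun x => Subtype.ext (heven x)
    rw [this]
    exact isProperMap_fst_of_compactSpace
  have hfi : Function.Injective f := fun x y hxy => hinj (congrArg Subtype.val hxy)
  have hfs : Function.Surjective f := by
    rintro ⟨F, hF⟩
    rw [← hrange] at hF
    obtain ⟨x, rfl⟩ := hF
    exact ⟨x, rfl⟩
  have hfe : Topology.IsClosedEmbedding f :=
    .of_continuous_injective_isClosedMap hf hfi hproper.isClosedMap
  have hfo : Topology.IsOpenEmbedding f :=
    ⟨hfe.isEmbedding, by rw [hfs.range_eq]; exact isOpen_univ⟩
  exact ⟨(hU.preimage hce).isOpenEmbedding_subtypeVal.comp hfo, hrange, heven⟩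

end LocalTriviality

/-! ### The neat arithmetic group acts freely and properly discontinuously -/

section ProperDiscontinuity

variable {g : ℕ} {ι : Type*} [Fintype ι] [DecidableEq ι]

lemma norm_conj (v : HC g) : ‖conj g v‖ = ‖v‖ := by
  simp [EuclideanSpace.norm_eq]

lemma norm_Q_le (v w : HC g) : ‖Q g v w‖ ≤ ∑ _i : Fin g, 2 * (‖v‖ * ‖w‖) := by
  rw [Q_sum]
  refine (norm_sum_le _ _).trans (Finset.sum_le_sum fun i _ => (norm_sub_le _ _).trans ?_)
  rw [norm_mul, norm_mul, two_mul]
  exact add_le_add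
    (mul_le_mul (PiLp.norm_apply_le v _) (PiLp.norm_apply_le w _) (norm_nonneg _) (norm_nonneg _))
    (mul_le_mul (PiLp.norm_apply_le v _) (PiLp.norm_apply_le w _) (norm_nonneg _) (norm_nonneg _))

omit [Fintype ι] [DecidableEq ι] in
lemma norm_frameBasis_le {E : ι → HC g} {C : ℝ} (hE : ∀ i, ‖E i‖ ≤ C) (k : ι ⊕ ι) :
    ‖frameBasis E k‖ ≤ C := by
  rcases k with i | i
  · exact hE i
  · rw [frameBasis_inr, norm_conj]
    exact hE i

omit [Fintype ι] [DecidableEq ι] in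
lemma norm_frameCoord_le {E : ι → HC g} {C : ℝ} (hE : ∀ i, ‖E i‖ ≤ C) (k : ι ⊕ ι) (v : HC g) :
    ‖frameCoord E k v‖ ≤ ∑ _i : Fin g, 2 * (‖v‖ * C) := by
  have key : ∀ w, ‖w‖ ≤ C → ‖Q g v w‖ ≤ ∑ _i : Fin g, 2 * (‖v‖ * C) := fun w hw =>
    (norm_Q_le v w).trans (Finset.sum_le_sum fun _ _ => by gcongr)
  rcases k with i | i
  · rw [frameCoord_inl, norm_mul, Complex.norm_I, one_mul]
    exact key _ (by rw [norm_conj]; exact hE i)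
  · rw [frameCoord_inr, norm_mul, norm_neg, Complex.norm_I, one_mul]
    exact key _ (hE i)

lemma norm_frameMul_le {E : ι → HC g} {C : ℝ} (hE : ∀ i, ‖E i‖ ≤ C) {u : Matrix ι ι ℂ}
    (hu : u ∈ Matrix.unitaryGroup ι ℂ) (i : ι) : ‖frameMul E u i‖ ≤ ∑ _j : ι, C := by
  refine (norm_sum_le _ _).trans (Finset.sum_le_sum fun j _ => ?_)
  rw [norm_smul]
  exact (mul_le_of_le_one_left (norm_nonneg _) (entry_norm_bound_of_unitary hu j i)).trans (hE j)

lemma spLin_single_apply (γ : Sp g) (i j : Fin g ⊕ Fin g) :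
    spLin γ (EuclideanSpace.single j 1) i = γ.1 i j := by
  simp [spLin, Matrix.toLpLin_apply]

/-- A symplectic matrix is bounded in terms of a frame and its image. -/
lemma mem_boundedSp_of_frames {E : ι → HC g} (hE : IsFrame E) {γ : Sp g} {C D : ℝ}
    (hC : ∀ i, ‖E i‖ ≤ C) (hD : ∀ i, ‖spLin γ (E i)‖ ≤ D) :
    γ ∈ boundedSp g (∑ _k : ι ⊕ ι, (∑ _i : Fin g, 2 * (1 * C)) * D) := by
  intro i j
  let e : HC g := EuclideanSpace.single j 1
  have he : ‖e‖ = 1 := by simp [e]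
  -- As γ is real, it sends (E, conj E) to (γE, conj γE); the image of a standard vector keeps its
  -- old coordinates with respect to the new basis.
  have h1 : spLin γ e = ∑ k, frameCoord E k e • frameBasis (fun i => spLin γ (E i)) k := by
    conv_lhs => rw [← hE.sum_frameCoord e]
    rw [map_sum]
    refine Finset.sum_congr rfl fun k _ => ?_
    rw [map_smul]
    rcases k with i | i
    · rfl
    · rw [frameBasis_inr, frameBasis_inr, conj_spLin]
  have h2 : |γ.1 i j| = ‖spLin γ e i‖ := by
    rw [spLin_single_apply, Complex.norm_real, Real.norm_eq_abs]
  rw [h2]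
  refine (PiLp.norm_apply_le _ i).trans ?_
  rw [h1]
  refine (norm_sum_le _ _).trans (Finset.sum_le_sum fun k _ => ?_)
  rw [norm_smul]
  have h3 := norm_frameCoord_le hC k e
  rw [he] at h3
  exact mul_le_mul h3 (norm_frameBasis_le (E := fun i => spLin γ (E i)) hD k) (norm_nonneg _)
    ((norm_nonneg _).trans h3)

/-- Near W₀ only finitely many γ ∈ Γ can move a point back near W₀; those other than 1 do not fix
W₀, and are excluded one at a time by shrinking the neighbourhood. -/
lemma exists_wandering_frame (ht : IsHodgeType (siegelNumbers g) fun _ : ι => 0)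
    (hι : Fintype.card ι = g) {Γ : Subgroup (Sp g)} (hΓ : IsArithmetic Γ) (hΓ' : IsNeat Γ)
    (W₀ : Siegel g) :
    ∃ U : Set (Siegel g), IsOpen U ∧ W₀ ∈ U ∧ (∀ γ ∈ Γ, ∀ W ∈ U, γ • W ∈ U → γ = 1) ∧
      ∃ s : U → {E : ι → HC g // IsFrame E}, Continuous s ∧ ∀ W : U, frameDomain ht (s W) = W := by
  obtain ⟨U, hU, hW₀, s, hs, hsU⟩ := exists_local_frame ht hι W₀
  -- The summand 1 makes the bound strict at W₀, so it holds on an open neighbourhood.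
  let C : ℝ := ∑ i, ‖(s ⟨W₀, hW₀⟩).1 i‖ + 1
  let V : Set (Siegel g) := Subtype.val '' {W : U | ∀ i, ‖(s W).1 i‖ < C}
  have hV : IsOpen V := by
    refine hU.isOpenMap_subtype_val _ ?_
    simp only [Set.ofPred_forall]
    exact isOpen_iInter_of_finite fun i => isOpen_lt
      ((continuous_apply i).comp (continuous_subtype_val.comp hs)).norm continuous_const
  have hW₀V : W₀ ∈ V := by
    refine ⟨⟨W₀, hW₀⟩, fun i => ?_, rfl⟩
    exact lt_add_of_le_of_pos (Finset.single_le_sum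
      (fun i _ => norm_nonneg ((s ⟨W₀, hW₀⟩).1 i)) (Finset.mem_univ i)) one_pos
  -- When W and γW both lie in V, γ s(W) and s(γW) are frames of one Lagrangian, so they differ by a
  -- unitary matrix, whose entries have norm at most 1. This bounds γ s(W), and with it γ.
  obtain ⟨D, hD⟩ : ∃ D, ∀ γ : Sp g, ∀ W ∈ V, γ • W ∈ V → γ ∈ boundedSp g D := by
    refine ⟨∑ _k : ι ⊕ ι, (∑ _i : Fin g, 2 * (1 * C)) * ∑ _j : ι, C, ?_⟩
    rintro γ _ ⟨W, hW, rfl⟩ ⟨W', hW', hWW'⟩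
    have h1 : frameDomain ht (s W') = frameDomain ht ⟨_, (s W).2.spLin γ⟩ := by
      rw [← smul_frameDomain, hsU, hsU, hWW']
    have h2 : frameFlag (fun _ => 0) (s W').1 0 =
        frameFlag (fun _ => 0) (fun i => spLin γ ((s W).1 i)) 0 :=
      congrArg (fun W : Siegel g => W.1 0) h1
    obtain ⟨u, hu, hEu⟩ := (s W').2.exists_unitary ((s W).2.spLin γ) fun i => by
      rw [h2]
      exact (((s W).2.spLin γ).frameBasis_mem_hodgePiece (fun _ => 0) (.inl i)).1
    refine mem_boundedSp_of_frames (s W).2 (C := C) (D := ∑ _j : ι, C) (fun i => (hW i).le)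
      fun i => ?_
    rw [congrFun hEu i]
    exact norm_frameMul_le (fun i => (hW' i).le) hu i
  have hfix : ∀ γ ∈ Γ, γ • W₀ = W₀ → γ = 1 := fun γ hγ hγW =>
    eq_one_of_pow_mem hΓ hΓ' hγ fun n => by
      have h1 : γ ^ n • W₀ = W₀ := by
        induction n with
        | zero => rw [pow_zero, one_smul]
        | succ n ih => rw [pow_succ, mul_smul, hγW, ih]
      exact hD _ W₀ hW₀V (by rwa [h1])
  have hfin := hΓ.finite_inter D
  have hsep : ∀ γ : Sp g, ∃ A : Set (Siegel g), IsOpen A ∧ W₀ ∈ A ∧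
      (γ ∈ Γ → ∀ W ∈ A, γ • W ∈ A → γ = 1) := by
    intro γ
    by_cases hγ : γ ∈ Γ ∧ γ ≠ 1
    · obtain ⟨A, B, hA, hB, hA0, hB0, hAB⟩ :=
        t2_separation (fun hc => hγ.2 (hfix γ hγ.1 hc) : γ • W₀ ≠ W₀)
      refine ⟨B ∩ (fun W => γ • W) ⁻¹' A, hB.inter (hA.preimage (continuous_const_smul γ)),
        ⟨hB0, hA0⟩, fun _ W hW hW' => ?_⟩
      exact absurd hW'.1 (Set.disjoint_left.1 hAB hW.2)
    · exact ⟨Set.univ, isOpen_univ, trivial, fun h1 _ _ _ => by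
        by_contra hc
        exact hγ ⟨h1, hc⟩⟩
  choose A hA hA0 hA1 using hsep
  let U' := V ∩ ⋂ γ ∈ (Γ : Set (Sp g)) ∩ boundedSp g D, A γ
  have hU'U : U' ⊆ U := by
    rintro _ ⟨⟨W, -, rfl⟩, -⟩
    exact W.2
  refine ⟨U', hV.inter (hfin.isOpen_biInter fun γ _ => hA γ), ⟨hW₀V, ?_⟩, ?_,
    fun W => s ⟨W, hU'U W.2⟩, ?_, fun W => hsU _⟩
  · exact Set.mem_iInter₂.2 fun γ _ => hA0 γ
  · intro γ hγ W hW hγW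
    have hb : γ ∈ (Γ : Set (Sp g)) ∩ boundedSp g D := ⟨hγ, hD γ W hW.1 hγW.1⟩
    exact hA1 γ hγ W (Set.mem_iInter₂.1 hW.2 γ hb) (Set.mem_iInter₂.1 hγW.2 γ hb)
  · exact hs.comp (continuous_subtype_val.subtype_mk _)

end ProperDiscontinuity

/-! ### Descent of the local product structure to the quotients by Γ -/

section Bundle

variable {g : ℕ} {h : ℤ →₀ ℕ}

instance (Γ : Subgroup (Sp g)) (h : ℤ → ℕ) : ContinuousConstSMul Γ (Domain g h) where
  continuous_const_smul γ := continuous_const_smul (γ : Sp g)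

lemma domainQuotient_mk_eq_iff {Γ : Subgroup (Sp g)} {h : ℤ → ℕ} {F F' : Domain g h} :
    (Quotient.mk'' F : DomainQuotient Γ h) = Quotient.mk'' F' ↔ ∃ γ ∈ Γ, γ • F' = F := by
  rw [Quotient.eq'', MulAction.orbitRel_apply]
  constructor
  · rintro ⟨γ, hγ⟩
    exact ⟨γ, γ.2, hγ⟩
  · rintro ⟨γ, hγ, hF⟩
    exact ⟨⟨γ, hγ⟩, hF⟩

/-- The wandering property makes the maps Ψ and j from U × C' and U to the two quotients injective,
hence open embeddings; the trivialization is Ψ⁻¹ followed by j × id. -/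
lemma exists_trivialization (h_symm : ∀ p : ℤ, h (-p - 1) = h p)
    (h_sum : ∑ p ∈ h.support.filter (0 ≤ ·), h p = g)
    {Γ : Subgroup (Sp g)} (hΓ : IsArithmetic Γ) (hΓ' : IsNeat Γ)
    (b : DomainQuotient Γ (siegelNumbers g)) :
    ∃ e : Bundle.Trivialization (FlagFiber h) (evenMapQuot Γ h), b ∈ e.baseSet := by
  have hg : Fintype.card (BlockIndex h) = g := card_blockIndex.trans h_sum
  have ht := isHodgeType_blockType h_symm
  have ht' := isHodgeType_zero hg
  obtain ⟨W₀, rfl⟩ : ∃ W₀, Quotient.mk'' W₀ = b := Quotient.mk''_surjective b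
  obtain ⟨U, hU, hW₀, hwand, s, hs, hsU⟩ := exists_wandering_frame ht' hg hΓ hΓ' W₀
  obtain ⟨hemb, hrange, heven⟩ := isOpenEmbedding_flagFamily ht ht' hg hU hs hsU
  have hne : Nonempty U := ⟨⟨W₀, hW₀⟩⟩
  let Ψ : U × FlagFiber h → DomainQuotient Γ h := fun x => Quotient.mk'' (flagFamily ht s x)
  let j : U → DomainQuotient Γ (siegelNumbers g) := fun W => Quotient.mk'' W.1
  have hqD : IsOpenQuotientMap (Quotient.mk'' : Domain g h → DomainQuotient Γ h) :=
    MulAction.isOpenQuotientMap_quotientMk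
  have hqS : IsOpenQuotientMap
      (Quotient.mk'' : Siegel g → DomainQuotient Γ (siegelNumbers g)) :=
    MulAction.isOpenQuotientMap_quotientMk
  have hΨ : Topology.IsOpenEmbedding Ψ := by
    refine .of_continuous_injective_isOpenMap (hqD.continuous.comp hemb.continuous) ?_
      (hqD.isOpenMap.comp hemb.isOpenMap)
    intro x y hxy
    obtain ⟨γ, hγ, hxy⟩ := domainQuotient_mk_eq_iff.1 hxy
    have h1 : γ • y.1.1 = x.1.1 := by
      rw [← heven, ← heven, ← evenMap_smul, hxy]
    have h2 : γ = 1 := hwand γ hγ _ y.1.2 (by rw [h1]; exact x.1.2)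
    rw [h2, one_smul] at hxy
    exact (hemb.injective hxy).symm
  have hj : Topology.IsOpenEmbedding j := by
    refine .of_continuous_injective_isOpenMap (hqS.continuous.comp continuous_subtype_val) ?_
      (hqS.isOpenMap.comp hU.isOpenMap_subtype_val)
    intro x y hxy
    obtain ⟨γ, hγ, hxy⟩ := domainQuotient_mk_eq_iff.1 hxy
    have h2 : γ = 1 := hwand γ hγ _ y.2 (by rw [hxy]; exact x.2)
    rw [h2, one_smul] at hxy
    exact (Subtype.ext hxy).symm
  have hpΨ : ∀ x, evenMapQuot Γ h (Ψ x) = j x.1 := fun x =>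
    congrArg (Quotient.mk'' : Siegel g → DomainQuotient Γ (siegelNumbers g)) (heven x)
  -- A point over the image of U has a representative whose even part lies in U, after a translation
  -- by Γ.
  have hrangeΨ : Set.range Ψ = evenMapQuot Γ h ⁻¹' Set.range j := by
    refine Set.Subset.antisymm ?_ fun z hz => ?_
    · rintro _ ⟨x, rfl⟩
      exact ⟨x.1, (hpΨ x).symm⟩
    · obtain ⟨F, rfl⟩ := Quotient.mk''_surjective z
      obtain ⟨W, hW⟩ := hz
      obtain ⟨γ, hγ, hγW⟩ := domainQuotient_mk_eq_iff.1
        (show (Quotient.mk'' W.1 : DomainQuotient Γ (siegelNumbers g)) =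
          Quotient.mk'' (evenMap g h F) from hW)
      have h1 : γ • F ∈ Set.range (flagFamily ht s) := by
        rw [hrange, Set.mem_preimage, evenMap_smul, hγW]
        exact W.2
      obtain ⟨x, hx⟩ := h1
      exact ⟨x, domainQuotient_mk_eq_iff.2 ⟨γ, hγ, hx.symm⟩⟩
  have hk : Topology.IsOpenEmbedding (Prod.map j (id : FlagFiber h → FlagFiber h)) :=
    hj.prodMap .id
  let e₁ := hΨ.toOpenPartialHomeomorph Ψ
  let e₂ := hk.toOpenPartialHomeomorph (Prod.map j (id : FlagFiber h → FlagFiber h))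
  refine ⟨{ toOpenPartialHomeomorph := e₁.symm.trans e₂
            baseSet := Set.range j
            open_baseSet := hj.isOpen_range
            source_eq := ?_
            target_eq := ?_
            proj_toFun := ?_ }, ⟨⟨W₀, hW₀⟩, rfl⟩⟩
  · rw [← hrangeΨ]
    simp [e₁, e₂]
  · simp [e₁, e₂, Set.range_prodMap]
  · intro z hz
    obtain ⟨x, rfl⟩ : z ∈ Set.range Ψ := by simpa [e₁, e₂] using hz
    have h1 : e₁.symm (Ψ x) = x := e₁.left_inv (by simp [e₁])
    change (Prod.map j id (e₁.symm (Ψ x))).1 = _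
    rw [h1, hpΨ]
    rfl

end Bundle

/-! ### Logarithms of unitary matrices near the identity -/

section Logarithm

variable {ι : Type*} [Fintype ι] [DecidableEq ι]

open Filter Topology
open scoped Matrix.Norms.Operator

/-- A local inverse of the exponential of complex matrices. -/
noncomputable def expHomeo (ι : Type*) [Fintype ι] [DecidableEq ι] :
    OpenPartialHomeomorph (Matrix ι ι ℂ) (Matrix ι ι ℂ) :=
  HasStrictFDerivAt.toOpenPartialHomeomorph (𝕜 := ℝ) (NormedSpace.exp : Matrix ι ι ℂ → Matrix ι ι ℂ)
    (f' := ContinuousLinearEquiv.refl ℝ _) (a := 0) hasStrictFDerivAt_exp_zero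

lemma zero_mem_expHomeo_source : (0 : Matrix ι ι ℂ) ∈ (expHomeo ι).source :=
  HasStrictFDerivAt.mem_toOpenPartialHomeomorph_source (𝕜 := ℝ)
    (f := (NormedSpace.exp : Matrix ι ι ℂ → Matrix ι ι ℂ))
    (f' := ContinuousLinearEquiv.refl ℝ _) (a := 0) hasStrictFDerivAt_exp_zero

lemma expHomeo_apply (X : Matrix ι ι ℂ) : expHomeo ι X = NormedSpace.exp X := rfl

lemma exp_neg_mul_exp (X : Matrix ι ι ℂ) : NormedSpace.exp (-X) * NormedSpace.exp X = 1 := by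
  rw [← Matrix.exp_add_of_commute _ _ (Commute.neg_left (Commute.refl X)), neg_add_cancel,
    NormedSpace.exp_zero]

lemma star_eq_exp_neg {X k : Matrix ι ι ℂ} (hX : NormedSpace.exp X = k)
    (hk : k ∈ Matrix.unitaryGroup ι ℂ) : star k = NormedSpace.exp (-X) := by
  calc star k = NormedSpace.exp (-X) * NormedSpace.exp X * star k := by
        rw [exp_neg_mul_exp, one_mul]
    _ = _ := by rw [mul_assoc, hX, Matrix.mem_unitaryGroup_iff.1 hk, mul_one]

lemma exp_mem_unitaryGroup {X : Matrix ι ι ℂ} (hX : star X = -X) :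
    NormedSpace.exp X ∈ Matrix.unitaryGroup ι ℂ := by
  rw [Matrix.mem_unitaryGroup_iff', NormedSpace.star_exp, hX, exp_neg_mul_exp]

/-- Unitary matrices near the identity have skew-Hermitian logarithms, with the same commutation
relation with a given matrix. -/
lemma exists_log {P : Matrix ι ι ℂ} (hP : IsUnit P) :
    ∃ L : Matrix ι ι ℂ → Matrix ι ι ℂ, Tendsto L (𝓝 1) (𝓝 0) ∧
      ∀ᶠ k in 𝓝 (1 : Matrix ι ι ℂ), NormedSpace.exp (L k) = k ∧
        (k ∈ Matrix.unitaryGroup ι ℂ → star (L k) = -L k) ∧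
        (P * k = k * P → P * L k = L k * P) := by
  have h1 : (1 : Matrix ι ι ℂ) ∈ (expHomeo ι).target := by
    have := (expHomeo ι).map_source zero_mem_expHomeo_source
    rwa [expHomeo_apply, NormedSpace.exp_zero] at this
  have h2 : (expHomeo ι).symm 1 = 0 := by
    have := (expHomeo ι).left_inv zero_mem_expHomeo_source
    rwa [expHomeo_apply, NormedSpace.exp_zero] at this
  have hL : Tendsto (expHomeo ι).symm (𝓝 1) (𝓝 0) := by
    have := (expHomeo ι).continuousAt_symm h1
    rwa [ContinuousAt, h2] at this
  have hs : (expHomeo ι).source ∈ 𝓝 (0 : Matrix ι ι ℂ) :=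
    (expHomeo ι).open_source.mem_nhds zero_mem_expHomeo_source
  have e1 : ∀ᶠ Y in 𝓝 (0 : Matrix ι ι ℂ), star Y ∈ (expHomeo ι).source := by
    have : Tendsto (star : Matrix ι ι ℂ → _) (𝓝 0) (𝓝 (star 0)) := continuous_star.tendsto 0
    rw [star_zero] at this
    exact this hs
  have e2 : ∀ᶠ Y in 𝓝 (0 : Matrix ι ι ℂ), -Y ∈ (expHomeo ι).source := by
    have : Tendsto (fun Y : Matrix ι ι ℂ => -Y) (𝓝 0) (𝓝 (-0)) := continuous_neg.tendsto 0
    rw [neg_zero] at this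
    exact this hs
  have e3 : ∀ᶠ Y in 𝓝 (0 : Matrix ι ι ℂ), P * Y * P⁻¹ ∈ (expHomeo ι).source := by
    have : Tendsto (fun Y : Matrix ι ι ℂ => P * Y * P⁻¹) (𝓝 0) (𝓝 (P * 0 * P⁻¹)) :=
      ((continuous_const.mul continuous_id).mul continuous_const).tendsto 0
    rw [mul_zero, zero_mul] at this
    exact this hs
  refine ⟨(expHomeo ι).symm, hL, ?_⟩
  filter_upwards [(expHomeo ι).open_target.mem_nhds h1, hL.eventually e1, hL.eventually e2,
    hL.eventually e3] with k hk h1 h2 h3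
  have hexp : NormedSpace.exp ((expHomeo ι).symm k) = k := (expHomeo ι).right_inv hk
  refine ⟨hexp, fun hu => ?_, fun hc => ?_⟩
  -- Both L(k)* and -L(k) are logarithms of k* = k⁻¹ in the region where exp is injective.
  -- Conjugation by P is compared in the same way below.
  · refine (expHomeo ι).injOn h1 h2 ?_
    rw [expHomeo_apply, expHomeo_apply, ← NormedSpace.star_exp, hexp, star_eq_exp_neg hexp hu]
  · have hPP : P * P⁻¹ = 1 := Matrix.mul_nonsing_inv P ((Matrix.isUnit_iff_isUnit_det P).1 hP)
    have hPP' : P⁻¹ * P = 1 := Matrix.nonsing_inv_mul P ((Matrix.isUnit_iff_isUnit_det P).1 hP)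
    have h4 : P * (expHomeo ι).symm k * P⁻¹ = (expHomeo ι).symm k := by
      refine (expHomeo ι).injOn h3 ((expHomeo ι).map_target hk) ?_
      rw [expHomeo_apply, expHomeo_apply, Matrix.exp_conj _ _ hP, hexp, hc, mul_assoc, hPP, mul_one]
    conv_rhs => rw [← h4]
    rw [mul_assoc, hPP', mul_one]

/-- If S is Hermitian and exp S unitary, then exp S = (exp S)* = exp(-S), so injectivity near 0
gives S = -S. -/
lemma eventually_eq_zero_of_exp_mem_unitaryGroup :
    ∀ᶠ S in 𝓝 (0 : Matrix ι ι ℂ), star S = S →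
      NormedSpace.exp S ∈ Matrix.unitaryGroup ι ℂ → S = 0 := by
  have hs : (expHomeo ι).source ∈ 𝓝 (0 : Matrix ι ι ℂ) :=
    (expHomeo ι).open_source.mem_nhds zero_mem_expHomeo_source
  have e2 : ∀ᶠ Y in 𝓝 (0 : Matrix ι ι ℂ), -Y ∈ (expHomeo ι).source := by
    have : Tendsto (fun Y : Matrix ι ι ℂ => -Y) (𝓝 0) (𝓝 (-0)) := continuous_neg.tendsto 0
    rw [neg_zero] at this
    exact this hs
  filter_upwards [hs, e2] with S h1 h2 hS hu
  have h3 : S = -S := by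
    refine (expHomeo ι).injOn h1 h2 ?_
    rw [expHomeo_apply, expHomeo_apply, ← star_eq_exp_neg rfl hu, NormedSpace.star_exp, hS]
  ext i j
  exact self_eq_neg.1 (congrFun (congrFun h3 i) j)

end Logarithm

/-! ### Off-diagonal, block-diagonal and Hermitian parts of a matrix, and their exponentials -/

section Slice

variable (h : ℤ →₀ ℕ)

/-- The skew-Hermitian matrices with vanishing diagonal blocks. -/
def offDiagSkew : Submodule ℝ (Matrix (BlockIndex h) (BlockIndex h) ℂ) where
  carrier := {X | star X = -X ∧ ∀ i j, i.1 = j.1 → X i j = 0}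
  zero_mem' := ⟨by simp, fun _ _ _ => rfl⟩
  add_mem' := by
    rintro X Y ⟨h1, h2⟩ ⟨h3, h4⟩
    exact ⟨by rw [star_add, h1, h3, neg_add], fun i j hij => by
      rw [Matrix.add_apply, h2 i j hij, h4 i j hij, add_zero]⟩
  smul_mem' := by
    rintro c X ⟨h1, h2⟩
    exact ⟨by rw [star_smul, h1, star_trivial, smul_neg], fun i j hij => by
      rw [Matrix.smul_apply, h2 i j hij, smul_zero]⟩

/-- The block-diagonal part of a matrix. -/
def blockPart : Matrix (BlockIndex h) (BlockIndex h) ℂ →ₗ[ℝ]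
    Matrix (BlockIndex h) (BlockIndex h) ℂ where
  toFun Z := Matrix.of fun i j => if i.1 = j.1 then Z i j else 0
  map_add' Z W := by
    ext i j
    by_cases hij : i.1 = j.1 <;> simp [hij]
  map_smul' c Z := by
    ext i j
    by_cases hij : i.1 = j.1 <;> simp [hij]

/-- The skew-Hermitian part of a matrix. -/
noncomputable def skewPart : Matrix (BlockIndex h) (BlockIndex h) ℂ →ₗ[ℝ]
    Matrix (BlockIndex h) (BlockIndex h) ℂ where
  toFun Z := (2⁻¹ : ℝ) • (Z - star Z)
  map_add' Z W := by rw [star_add, ← smul_add]; congr 1; abel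
  map_smul' c Z := by
    rw [star_smul, star_trivial, ← smul_sub, smul_comm]
    rfl

variable {h}

lemma blockPart_apply (Z : Matrix (BlockIndex h) (BlockIndex h) ℂ) (i j : BlockIndex h) :
    blockPart h Z i j = if i.1 = j.1 then Z i j else 0 := rfl

lemma skewPart_apply (Z : Matrix (BlockIndex h) (BlockIndex h) ℂ) :
    skewPart h Z = (2⁻¹ : ℝ) • (Z - star Z) := rfl

lemma star_skewPart (Z : Matrix (BlockIndex h) (BlockIndex h) ℂ) :
    star (skewPart h Z) = -skewPart h Z := by
  rw [skewPart_apply, star_smul, star_trivial, star_sub, star_star, ← smul_neg, neg_sub]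

lemma skewPart_of_star {Z : Matrix (BlockIndex h) (BlockIndex h) ℂ} (hZ : star Z = -Z) :
    skewPart h Z = Z := by
  rw [skewPart_apply, hZ, sub_neg_eq_add, ← two_smul ℝ Z, smul_smul]
  norm_num

lemma star_sub_skewPart (Z : Matrix (BlockIndex h) (BlockIndex h) ℂ) :
    star (Z - skewPart h Z) = Z - skewPart h Z := by
  have h1 : Z - star Z = skewPart h Z + skewPart h Z := by
    rw [skewPart_apply, ← add_smul]
    norm_num
  rw [star_sub, star_skewPart, eq_sub_iff_add_eq.2 (sub_eq_iff_eq_add'.1 h1).symm]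
  abel

lemma star_blockPart {Z : Matrix (BlockIndex h) (BlockIndex h) ℂ} (hZ : star Z = -Z) :
    star (blockPart h Z) = -blockPart h Z := by
  ext i j
  have h1 := congrFun (congrFun hZ i) j
  rw [Matrix.star_apply, Matrix.neg_apply] at h1
  rw [Matrix.star_apply, Matrix.neg_apply, blockPart_apply, blockPart_apply]
  by_cases hij : i.1 = j.1
  · rw [if_pos hij, if_pos hij.symm, h1]
  · rw [if_neg hij, if_neg (Ne.symm hij), star_zero, neg_zero]

lemma commute_blockPart (Z : Matrix (BlockIndex h) (BlockIndex h) ℂ) :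
    blockScalar h * blockPart h Z = blockPart h Z * blockScalar h :=
  (commute_blockScalar_iff _).2 fun i j hij => by rw [blockPart_apply, if_neg hij]

lemma blockPart_of_commute {Z : Matrix (BlockIndex h) (BlockIndex h) ℂ}
    (hZ : blockScalar h * Z = Z * blockScalar h) : blockPart h Z = Z := by
  ext i j
  rw [blockPart_apply]
  split_ifs with hij
  · rfl
  · exact ((commute_blockScalar_iff Z).1 hZ i j hij).symm

lemma blockPart_of_mem {Z : Matrix (BlockIndex h) (BlockIndex h) ℂ} (hZ : Z ∈ offDiagSkew h) :
    blockPart h Z = 0 := by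
  ext i j
  rw [blockPart_apply]
  split_ifs with hij
  · exact hZ.2 i j hij
  · rfl

lemma slicePart_mem (Z : Matrix (BlockIndex h) (BlockIndex h) ℂ) :
    skewPart h Z - blockPart h (skewPart h Z) ∈ offDiagSkew h := by
  refine ⟨?_, fun i j hij => ?_⟩
  · rw [star_sub, star_skewPart, star_blockPart (star_skewPart Z)]
    abel
  · rw [Matrix.sub_apply, blockPart_apply, if_pos hij, sub_self]

/-- The projection of a matrix to its off-diagonal skew-Hermitian part. -/
noncomputable def slicePart (h : ℤ →₀ ℕ) :
    Matrix (BlockIndex h) (BlockIndex h) ℂ →ₗ[ℝ] offDiagSkew h :=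
  LinearMap.codRestrict _ (skewPart h - blockPart h ∘ₗ skewPart h) slicePart_mem

lemma slicePart_coe (Z : Matrix (BlockIndex h) (BlockIndex h) ℂ) :
    (slicePart h Z : Matrix (BlockIndex h) (BlockIndex h) ℂ) =
      skewPart h Z - blockPart h (skewPart h Z) := rfl

lemma slicePart_add {X Y : Matrix (BlockIndex h) (BlockIndex h) ℂ} (hX : X ∈ offDiagSkew h)
    (hY : star Y = -Y) (hY' : blockScalar h * Y = Y * blockScalar h) :
    (slicePart h (X + Y) : Matrix (BlockIndex h) (BlockIndex h) ℂ) = X := by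
  rw [slicePart_coe, map_add, map_add, skewPart_of_star hX.1, skewPart_of_star hY,
    blockPart_of_mem hX, blockPart_of_commute hY']
  abel

open scoped Matrix.Norms.Operator

/-- The product of the exponentials of the parts of a matrix. -/
noncomputable def sliceMap (h : ℤ →₀ ℕ) (Z : Matrix (BlockIndex h) (BlockIndex h) ℂ) :
    Matrix (BlockIndex h) (BlockIndex h) ℂ :=
  NormedSpace.exp (slicePart h Z : Matrix (BlockIndex h) (BlockIndex h) ℂ) *
    NormedSpace.exp (blockPart h (skewPart h Z)) * NormedSpace.exp (Z - skewPart h Z)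

lemma sliceMap_add {X Y : Matrix (BlockIndex h) (BlockIndex h) ℂ} (hX : X ∈ offDiagSkew h)
    (hY : star Y = -Y) (hY' : blockScalar h * Y = Y * blockScalar h) :
    sliceMap h (X + Y) = NormedSpace.exp X * NormedSpace.exp Y := by
  rw [sliceMap, slicePart_add hX hY hY', map_add, map_add, skewPart_of_star hX.1,
    skewPart_of_star hY, blockPart_of_mem hX, blockPart_of_commute hY', zero_add, sub_self,
    NormedSpace.exp_zero, mul_one]

/-- At 0 the derivative of the product is the sum of the three linear parts, which is the identity;
so the inverse function theorem applies to `sliceMap`. -/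
lemma hasStrictFDerivAt_sliceMap :
    HasStrictFDerivAt (sliceMap h)
      (ContinuousLinearEquiv.refl ℝ (Matrix (BlockIndex h) (BlockIndex h) ℂ) :
        Matrix (BlockIndex h) (BlockIndex h) ℂ →L[ℝ] Matrix (BlockIndex h) (BlockIndex h) ℂ) 0 := by
  have key : ∀ T : Matrix (BlockIndex h) (BlockIndex h) ℂ →L[ℝ]
      Matrix (BlockIndex h) (BlockIndex h) ℂ,
      HasStrictFDerivAt (fun Z => NormedSpace.exp (T Z)) T 0 := by
    intro T
    have h1 : HasStrictFDerivAt (NormedSpace.exp : Matrix (BlockIndex h) (BlockIndex h) ℂ → _)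
        (1 : Matrix (BlockIndex h) (BlockIndex h) ℂ →L[ℝ] _) (T 0) := by
      rw [map_zero]
      exact hasStrictFDerivAt_exp_zero
    exact h1.comp 0 T.hasStrictFDerivAt
  have h1 := key (LinearMap.toContinuousLinearMap ((offDiagSkew h).subtype ∘ₗ slicePart h))
  have h2 := key (LinearMap.toContinuousLinearMap (blockPart h ∘ₗ skewPart h))
  have h3 := key (LinearMap.toContinuousLinearMap (LinearMap.id - skewPart h))
  refine ((h1.mul' h2).mul' h3).congr_fderiv ?_
  ext1 Z
  simp only [map_zero, NormedSpace.exp_zero, Pi.mul_apply, mul_one]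
  change (1 : Matrix (BlockIndex h) (BlockIndex h) ℂ) * (Z - skewPart h Z) +
    ((1 : Matrix (BlockIndex h) (BlockIndex h) ℂ) * blockPart h (skewPart h Z) +
      (skewPart h Z - blockPart h (skewPart h Z)) * 1) * 1 = Z
  rw [one_mul, one_mul, mul_one, mul_one]
  abel

end Slice

/-! ### Charts on the fiber -/

section SliceChart

variable {h : ℤ →₀ ℕ}

open Filter Topology
open scoped Matrix.Norms.Operator

lemma continuous_exp : Continuous
    (NormedSpace.exp : Matrix (BlockIndex h) (BlockIndex h) ℂ → _) := NormedSpace.exp_continuous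

/-- The exponential of a skew-Hermitian matrix, as a unitary matrix. -/
noncomputable def unitaryExp (X : Matrix (BlockIndex h) (BlockIndex h) ℂ) (hX : star X = -X) :
    Matrix.unitaryGroup (BlockIndex h) ℂ :=
  ⟨NormedSpace.exp X, exp_mem_unitaryGroup hX⟩

/-- The slice to the block-diagonal group given by the exponential map. -/
noncomputable def sliceFlag (X : offDiagSkew h) : FlagFiber h :=
  (unitaryExp X.1 X.2.1 : Matrix.unitaryGroup (BlockIndex h) ℂ)

lemma continuous_sliceFlag : Continuous (sliceFlag : offDiagSkew h → FlagFiber h) :=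
  continuous_quotient_mk'.comp
    ((continuous_exp.comp continuous_subtype_val).subtype_mk _)

/-- The local inverse of `sliceMap`. -/
noncomputable def sliceHomeo (h : ℤ →₀ ℕ) :
    OpenPartialHomeomorph (Matrix (BlockIndex h) (BlockIndex h) ℂ)
      (Matrix (BlockIndex h) (BlockIndex h) ℂ) :=
  hasStrictFDerivAt_sliceMap.toOpenPartialHomeomorph (sliceMap h)

lemma sliceHomeo_source_mem_nhds :
    (sliceHomeo h).source ∈ 𝓝 (0 : Matrix (BlockIndex h) (BlockIndex h) ℂ) :=
  (sliceHomeo h).open_source.mem_nhds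
    hasStrictFDerivAt_sliceMap.mem_toOpenPartialHomeomorph_source

lemma sliceMap_coe (X : offDiagSkew h) : sliceMap h X.1 = NormedSpace.exp X.1 := by
  have := sliceMap_add X.2 (Y := 0) (by simp) (by simp)
  rwa [add_zero, NormedSpace.exp_zero, mul_one] at this

/-- If exp X and exp X' define the same coset, then exp(-X) exp X' = exp Y with Y small,
skew-Hermitian and block diagonal. So `sliceMap` agrees at X + Y and X'; local injectivity gives X +
Y = X', and the off-diagonal parts give X = X'. -/
lemma exists_injOn_sliceFlag :
    ∃ V ∈ 𝓝 (0 : offDiagSkew h), Set.InjOn sliceFlag V := by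
  obtain ⟨L, hL, hL1⟩ := exists_log (isUnit_blockScalar (h := h))
  have hk : Tendsto (fun x : offDiagSkew h × offDiagSkew h =>
      NormedSpace.exp (-x.1.1) * NormedSpace.exp x.2.1) (𝓝 0 ×ˢ 𝓝 0) (𝓝 1) := by
    have hc : Continuous (fun x : offDiagSkew h × offDiagSkew h =>
        NormedSpace.exp (-x.1.1) * NormedSpace.exp x.2.1) :=
      (continuous_exp.comp (continuous_subtype_val.comp continuous_fst).neg).mul
        (continuous_exp.comp (continuous_subtype_val.comp continuous_snd))
    have := hc.tendsto (0, 0)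
    simpa [nhds_prod_eq] using this
  have hs : Tendsto (fun x : offDiagSkew h × offDiagSkew h =>
      x.1.1 + L (NormedSpace.exp (-x.1.1) * NormedSpace.exp x.2.1)) (𝓝 0 ×ˢ 𝓝 0) (𝓝 0) := by
    have h1 : Tendsto (fun x : offDiagSkew h × offDiagSkew h => x.1.1) (𝓝 0 ×ˢ 𝓝 0) (𝓝 0) :=
      (continuous_subtype_val.tendsto (0 : offDiagSkew h)).comp tendsto_fst
    simpa using h1.add (hL.comp hk)
  have hx : Tendsto (fun x : offDiagSkew h × offDiagSkew h => x.2.1) (𝓝 0 ×ˢ 𝓝 0) (𝓝 0) :=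
    (continuous_subtype_val.tendsto (0 : offDiagSkew h)).comp tendsto_snd
  have hev := (hk.eventually hL1).and ((hs.eventually sliceHomeo_source_mem_nhds).and
    (hx.eventually sliceHomeo_source_mem_nhds))
  obtain ⟨V, hV, hVV⟩ := mem_prod_self_iff.1 hev
  refine ⟨V, hV, fun X hX X' hX' hXX' => ?_⟩
  obtain ⟨⟨h1, h2, h3⟩, h4, h5⟩ := hVV (Set.mk_mem_prod hX hX')
  simp only at h1 h2 h3 h4 h5
  set k := NormedSpace.exp (-X.1) * NormedSpace.exp X'.1 with hk
  have hmem := QuotientGroup.eq.1 hXX'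
  have hkeq : ((unitaryExp X.1 X.2.1)⁻¹ * unitaryExp X'.1 X'.2.1).1 = k := by
    change star (NormedSpace.exp X.1) * NormedSpace.exp X'.1 = k
    rw [NormedSpace.star_exp, X.2.1]
  rw [mem_range_blockUnitary_iff_commute, hkeq] at hmem
  have hku : k ∈ Matrix.unitaryGroup (BlockIndex h) ℂ := hkeq ▸ Subtype.property _
  have h6 : sliceMap h (X.1 + L k) = sliceMap h X'.1 := by
    rw [sliceMap_add X.2 (h2 hku) (h3 hmem), h1, sliceMap_coe, hk, ← mul_assoc]
    have := exp_neg_mul_exp (-X.1)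
    rw [neg_neg] at this
    rw [this, one_mul]
  have h7 : X.1 + L k = X'.1 := (sliceHomeo h).injOn h4 h5 h6
  have h8 := slicePart_add X.2 (h2 hku) (h3 hmem)
  have h9 := slicePart_add X'.2 (Y := 0) (by simp) (by simp)
  rw [h7] at h8
  rw [add_zero] at h9
  exact Subtype.ext (h8.symm.trans h9)

/-- This is openness of the slice. A unitary u near exp X is `sliceMap h Z` with Z near X; its
Hermitian factor is then unitary, hence trivial, and the block-diagonal factor disappears in the
quotient. -/
lemma nhds_sliceFlag_le :
    ∀ᶠ X in 𝓝 (0 : offDiagSkew h), 𝓝 (sliceFlag X) ≤ map sliceFlag (𝓝 X) := by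
  have h0 : Tendsto (fun X : offDiagSkew h => X.1) (𝓝 0) (𝓝 0) :=
    continuous_subtype_val.tendsto (0 : offDiagSkew h)
  have hps : Continuous fun Z : Matrix (BlockIndex h) (BlockIndex h) ℂ => Z - skewPart h Z :=
    continuous_id.sub (skewPart h).continuous_of_finiteDimensional
  filter_upwards [h0.eventually sliceHomeo_source_mem_nhds] with X hX
  rw [le_map_iff]
  intro T hT
  rw [sliceFlag, QuotientGroup.nhds_eq, mem_map]
  have hXt : sliceMap h X.1 ∈ (sliceHomeo h).target := (sliceHomeo h).map_source hX
  have hval : Tendsto (fun u : Matrix.unitaryGroup (BlockIndex h) ℂ => u.1)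
      (𝓝 (unitaryExp X.1 X.2.1)) (𝓝 (sliceMap h X.1)) := by
    rw [sliceMap_coe]
    exact continuous_subtype_val.tendsto (unitaryExp X.1 X.2.1)
  have hZ : Tendsto (fun u : Matrix.unitaryGroup (BlockIndex h) ℂ => (sliceHomeo h).symm u.1)
      (𝓝 (unitaryExp X.1 X.2.1)) (𝓝 X.1) := by
    have h1 := (sliceHomeo h).continuousAt_symm hXt
    have h2 : (sliceHomeo h).symm (sliceMap h X.1) = X.1 := (sliceHomeo h).left_inv hX
    rw [ContinuousAt, h2] at h1
    exact h1.comp hval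
  have hX0 : X.1 - skewPart h X.1 = 0 := by rw [skewPart_of_star X.2.1, sub_self]
  have e1 : ∀ᶠ u in 𝓝 (unitaryExp X.1 X.2.1),
      slicePart h ((sliceHomeo h).symm u.1) ∈ T := by
    have h1 : slicePart h X.1 = X := Subtype.ext (by
      have := slicePart_add X.2 (Y := 0) (by simp) (by simp)
      rwa [add_zero] at this)
    have h2 := ((slicePart h).continuous_of_finiteDimensional.tendsto X.1).comp hZ
    rw [h1] at h2
    exact h2 hT
  have e2 := (((hps.tendsto X.1).comp hZ).congr' .rfl).eventually
    (by rw [hX0]; exact eventually_eq_zero_of_exp_mem_unitaryGroup)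
  filter_upwards [e1, e2, hval ((sliceHomeo h).open_target.mem_nhds hXt)] with u hu1 hu2 hu3
  refine ⟨_, hu1, QuotientGroup.eq.2 ?_⟩
  set Z := (sliceHomeo h).symm u.1 with hZdef
  have hZu : sliceMap h Z = u.1 := (sliceHomeo h).right_inv hu3
  let a := unitaryExp (slicePart h Z).1 (slicePart h Z).2.1
  let b := unitaryExp (blockPart h (skewPart h Z)) (star_blockPart (star_skewPart Z))
  have hab : (a * b).1 * NormedSpace.exp (Z - skewPart h Z) = u.1 := hZu
  have hexp : NormedSpace.exp (Z - skewPart h Z) = ((a * b)⁻¹ * u).1 := by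
    change _ = star (a * b).1 * u.1
    rw [← hab, ← mul_assoc, Matrix.mem_unitaryGroup_iff'.1 (a * b).2, one_mul]
  have hS : Z - skewPart h Z = 0 :=
    hu2 (star_sub_skewPart Z) (by
      change NormedSpace.exp (Z - skewPart h Z) ∈ _
      rw [hexp]
      exact Subtype.property _)
  have hub : a⁻¹ * u = b := by
    rw [hS, NormedSpace.exp_zero, mul_one] at hab
    rw [← Subtype.ext hab, inv_mul_cancel_left]
  rw [hub, mem_range_blockUnitary_iff_commute]
  exact ((Commute.exp_left (show Commute (blockPart h (skewPart h Z)) (blockScalar h) from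
    (commute_blockPart _).symm)).eq).symm

lemma exists_isOpenEmbedding_sliceFlag :
    ∃ V : Set (offDiagSkew h), IsOpen V ∧ 0 ∈ V ∧ IsOpenEmbedding fun X : V => sliceFlag X.1 := by
  obtain ⟨V, hV, hinj⟩ := exists_injOn_sliceFlag (h := h)
  obtain ⟨W, hW, hWo, h0⟩ := mem_nhds_iff.1 (inter_mem hV (nhds_sliceFlag_le (h := h)))
  refine ⟨W, hWo, h0, .of_continuous_injective_isOpenMap
    (continuous_sliceFlag.comp continuous_subtype_val) ?_ ?_⟩
  · exact fun X Y hXY => Subtype.ext (hinj (hW X.2).1 (hW Y.2).1 hXY)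
  · rw [isOpenMap_iff_nhds_le]
    intro X
    change 𝓝 (sliceFlag X.1) ≤ map (sliceFlag ∘ Subtype.val) (𝓝 X)
    rw [← map_map, map_nhds_subtype_coe_eq_nhds X.2 (hWo.mem_nhds X.2)]
    exact (hW X.2).2

lemma nonempty_chartedSpace {d : ℕ} (hd : finrank ℝ (offDiagSkew h) = d) :
    Nonempty (ChartedSpace (EuclideanSpace ℝ (Fin d)) (FlagFiber h)) := by
  obtain ⟨V, hV, h0, hemb⟩ := exists_isOpenEmbedding_sliceFlag (h := h)
  have hne : Nonempty V := ⟨⟨0, h0⟩⟩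
  let φ : offDiagSkew h ≃L[ℝ] EuclideanSpace ℝ (Fin d) :=
    ContinuousLinearEquiv.ofFinrankEq (by simp [hd])
  let c : OpenPartialHomeomorph (FlagFiber h) (EuclideanSpace ℝ (Fin d)) :=
    (hemb.toOpenPartialHomeomorph _).symm.trans
      ((hV.isOpenEmbedding_subtypeVal.toOpenPartialHomeomorph _).trans
        φ.toHomeomorph.toOpenPartialHomeomorph)
  have hc : ((1 : Matrix.unitaryGroup (BlockIndex h) ℂ) : FlagFiber h) ∈ c.source := by
    have h1 : sliceFlag (0 : offDiagSkew h) = (1 : Matrix.unitaryGroup (BlockIndex h) ℂ) := by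
      rw [sliceFlag]
      congr 1
      exact Subtype.ext NormedSpace.exp_zero
    have h2 : c.source = Set.range fun X : V => sliceFlag X.1 := by simp [c]
    rw [h2]
    exact ⟨⟨0, h0⟩, h1⟩
  -- The chart at the base point is carried to x by translating with a representative of x.
  let chart : FlagFiber h → OpenPartialHomeomorph (FlagFiber h) (EuclideanSpace ℝ (Fin d)) :=
    fun x => (Homeomorph.smul (x.out⁻¹ : Matrix.unitaryGroup (BlockIndex h) ℂ)
      ).toOpenPartialHomeomorph.trans c
  refine ⟨{ atlas := Set.range chart
            chartAt := chart
            mem_chart_source := fun x => ?_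
            chart_mem_atlas := fun x => ⟨x, rfl⟩ }⟩
  have h1 : (x.out⁻¹ : Matrix.unitaryGroup (BlockIndex h) ℂ) • x =
      ((1 : Matrix.unitaryGroup (BlockIndex h) ℂ) : FlagFiber h) := by
    conv_lhs => rw [← QuotientGroup.out_eq' x]
    rw [MulAction.Quotient.smul_coe]
    simp
  simp only [chart, OpenPartialHomeomorph.trans_source, Set.mem_inter_iff, Set.mem_preimage]
  refine ⟨trivial, ?_⟩
  change (x.out⁻¹ : Matrix.unitaryGroup (BlockIndex h) ℂ) • x ∈ c.source
  rw [h1]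
  exact hc

end SliceChart

/-! ### Dimension of the fiber -/

section Dimension

variable {h : ℤ →₀ ℕ}

lemma card_diag_blocks : Fintype.card {x : BlockIndex h × BlockIndex h // x.1.1 = x.2.1} =
    ∑ p ∈ h.support.filter (0 ≤ ·), h p ^ 2 := by
  have e : {x : BlockIndex h × BlockIndex h // x.1.1 = x.2.1} ≃
      Σ p : {p : ℤ // p ∈ h.support.filter (0 ≤ ·)}, Fin (h p.1) × Fin (h p.1) :=
    { toFun := fun x => ⟨x.1.1.1, x.1.1.2, x.2 ▸ x.1.2.2⟩
      invFun := fun y => ⟨(⟨y.1, y.2.1⟩, ⟨y.1, y.2.2⟩), rfl⟩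
      left_inv := by
        rintro ⟨⟨⟨p, i⟩, ⟨q, j⟩⟩, hpq⟩
        dsimp only at hpq
        subst hpq
        rfl
      right_inv := fun y => rfl }
  rw [Fintype.card_congr e, Fintype.card_sigma,
    ← Finset.sum_coe_sort (h.support.filter (0 ≤ ·))]
  simp [sq]

/-- Every complex matrix is uniquely X + iY with X, Y skew-Hermitian. So two copies of the slice
make up all matrices with zero diagonal blocks, of real dimension twice the number of off-diagonal
positions. -/
lemma finrank_offDiagSkew : 2 * finrank ℝ (offDiagSkew h) =
    2 * Fintype.card {x : BlockIndex h × BlockIndex h // ¬ x.1.1 = x.2.1} := by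
  let S := {x : BlockIndex h × BlockIndex h // ¬ x.1.1 = x.2.1}
  let f : (offDiagSkew h × offDiagSkew h) →ₗ[ℝ] (S → ℂ) :=
    { toFun := fun x s => x.1.1 s.1.1 s.1.2 + Complex.I * x.2.1 s.1.1 s.1.2
      map_add' := fun x y => by ext s; simp; ring
      map_smul' := fun c x => by ext s; simp; ring }
  have hskew : ∀ (X : offDiagSkew h) i j, starRingEnd ℂ (X.1 j i) = -X.1 i j := fun X i j =>
    congrFun (congrFun X.2.1 i) j
  have hf : Function.Bijective f := by
    constructor
    · rw [← LinearMap.ker_eq_bot, LinearMap.ker_eq_bot']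
      rintro ⟨X, Y⟩ hXY
      have h1 : ∀ i j, X.1 i j + Complex.I * Y.1 i j = 0 := fun i j => by
        by_cases hij : i.1 = j.1
        · rw [X.2.2 i j hij, Y.2.2 i j hij, mul_zero, add_zero]
        · exact congrFun hXY ⟨(i, j), hij⟩
      have h2 : ∀ i j, -X.1 i j + Complex.I * Y.1 i j = 0 := fun i j => by
        have := congrArg (starRingEnd ℂ) (h1 j i)
        rw [map_add, map_mul, Complex.conj_I, hskew, hskew, map_zero, neg_mul_neg] at this
        exact this
      have hY : ∀ i j, Y.1 i j = 0 := fun i j => by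
        have h3 : Complex.I * Y.1 i j = 0 := by linear_combination (h1 i j + h2 i j) / 2
        exact (mul_eq_zero.1 h3).resolve_left Complex.I_ne_zero
      have hX : ∀ i j, X.1 i j = 0 := fun i j => by
        have h3 := h1 i j
        rwa [hY, mul_zero, add_zero] at h3
      exact Prod.ext (Subtype.ext (Matrix.ext hX)) (Subtype.ext (Matrix.ext hY))
    · intro y
      let z : BlockIndex h → BlockIndex h → ℂ := fun i j =>
        if hij : i.1 = j.1 then 0 else y ⟨(i, j), hij⟩
      have hz : ∀ i j, i.1 = j.1 → z i j = 0 := fun i j hij => dif_pos hij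
      let X : offDiagSkew h := ⟨Matrix.of fun i j => (z i j - starRingEnd ℂ (z j i)) / 2, by
        refine ⟨?_, fun i j hij => ?_⟩
        · ext i j
          simp
          ring
        · simp [hz i j hij, hz j i hij.symm]⟩
      let Y : offDiagSkew h :=
        ⟨Matrix.of fun i j => -Complex.I * (z i j + starRingEnd ℂ (z j i)) / 2, by
          refine ⟨?_, fun i j hij => ?_⟩
          · ext i j
            simp
            ring
          · simp [hz i j hij, hz j i hij.symm]⟩
      refine ⟨(X, Y), funext fun s => ?_⟩
      have hs : z s.1.1 s.1.2 = y s := dif_neg s.2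
      change (z s.1.1 s.1.2 - starRingEnd ℂ (z s.1.2 s.1.1)) / 2 +
        Complex.I * (-Complex.I * (z s.1.1 s.1.2 + starRingEnd ℂ (z s.1.2 s.1.1)) / 2) = y s
      rw [← hs]
      linear_combination (-(z s.1.1 s.1.2 + starRingEnd ℂ (z s.1.2 s.1.1)) / 2) * Complex.I_mul_I
  have h1 := (LinearEquiv.ofBijective f hf).finrank_eq
  rw [finrank_prod, finrank_pi_fintype] at h1
  simp only [Complex.finrank_real_complex, Finset.sum_const, Finset.card_univ, smul_eq_mul] at h1
  rw [two_mul, h1, mul_comm]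

lemma finrank_offDiagSkew_add {g : ℕ} (h_sum : ∑ p ∈ h.support.filter (0 ≤ ·), h p = g) :
    finrank ℝ (offDiagSkew h) + ∑ p ∈ h.support.filter (0 ≤ ·), h p ^ 2 = g ^ 2 := by
  have h1 := finrank_offDiagSkew (h := h)
  have h2 := Fintype.card_subtype_compl (fun x : BlockIndex h × BlockIndex h => x.1.1 = x.2.1)
  have h3 := Fintype.card_subtype_le (fun x : BlockIndex h × BlockIndex h => x.1.1 = x.2.1)
  rw [card_diag_blocks, Fintype.card_prod, card_blockIndex, h_sum] at h2
  rw [card_diag_blocks, Fintype.card_prod, card_blockIndex, h_sum] at h3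
  rw [sq g]
  omega

end Dimension

end WeightNegOne

theorem mainTheorem6 (g : ℕ) (h : ℤ →₀ ℕ)
    (h_symm : ∀ p : ℤ, h (-p - 1) = h p)
    (h_sum : ∑ p ∈ h.support.filter (0 ≤ ·), h p = g)
    (Γ : Subgroup (WeightNegOne.Sp g))
    (h_arith : WeightNegOne.IsArithmetic Γ) (h_neat : WeightNegOne.IsNeat Γ) :
    (∀ b : WeightNegOne.DomainQuotient Γ (WeightNegOne.siegelNumbers g),
      ∃ e : Bundle.Trivialization (WeightNegOne.FlagFiber h) (WeightNegOne.evenMapQuot Γ h),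
        b ∈ e.baseSet) ∧
    (CompactSpace (WeightNegOne.FlagFiber h) ∧ T2Space (WeightNegOne.FlagFiber h) ∧
      ∃ d : ℕ, d + ∑ p ∈ h.support.filter (0 ≤ ·), h p ^ 2 = g ^ 2 ∧
        Nonempty (ChartedSpace (EuclideanSpace ℝ (Fin d)) (WeightNegOne.FlagFiber h))) ∧
    (∀ K : Subgroup (WeightNegOne.Sp g),
      Maximal (fun K' : Subgroup (WeightNegOne.Sp g) =>
        IsCompact (K' : Set (WeightNegOne.Sp g))) K → Γ ⊓ K = ⊥) :=
  ⟨fun b => WeightNegOne.exists_trivialization h_symm h_sum h_arith h_neat b,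
    ⟨inferInstance, inferInstance, _, WeightNegOne.finrank_offDiagSkew_add h_sum,
      WeightNegOne.nonempty_chartedSpace rfl⟩,
    fun _ hK => WeightNegOne.inf_eq_bot_of_isCompact h_arith h_neat hK.prop⟩
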